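/- Let $p$ be a prime and let $n,k\ge 1$ be integers. Write $\nu_p$ for the $p$-adic valuation, $\sigma_p(m)$ for the sum of the base $p$ digits of $m$, and $n=\sum_{i\ge 0} n_ip^i$ for the base $p$ expansion of $n$. A bottom segment of $n$ is a number of the form $\sum_{0\le i<b} n_ip^i+c\,p^b$ with $b\ge 0$ and $0\le c\le n_b$. For $l\in\mathbb Z$ the higher order Bernoulli polynomials $B_m^{(l)}(x)\in\mathbb Q[x]$ are defined by $\left(\frac{t}{e^t-1}\right)^l e^{tx}=\sum_{m\ge 0}B_m^{(l)}(x)\frac{t^m}{m!}$. A rational number $a\neq 0$ has a pole of order $M$ if $\nu_p(a)=-M$, and the maximum pole of $B_m^{(l)}(x)$ is the exponent of the highest power of $p$ in the denominator of any of its coefficients. Let $S(n,k)$ be the Stirling number of the second kind; for $1\le k\le n$, $S(n,k)$ is called an almost minimum zero case (AMZC) if $\nu_p(S(n,k))=\nu_p\binom nk-M$, where $M$ is the maximum pole of $B_{n-k}^{(-k)}(x)$. Let $B$ be a bottom segment of $n$ such that $0<k\le B$. Suppose that $p-1\mid B-k$ and $p\nmid\binom{n+(B-k)/(p-1)}{n}$,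 and let $M$ be the maximum pole of $B_{n-k}^{(-k)}(x)$. Then: (a) $M=\sigma_p(B-k)/(p-1)$, and the first occurrence of a pole of order $M$ among the coefficients of $B_{n-k}^{(-k)}(x)$, read from the highest degree down, is in degree $n-B$ (that is, $n-B$ is the largest degree whose coefficient has a pole of order $M$). (b) If moreover $p-1\mid n-k$, then $S(n,k)$ is an AMZC and $\nu_p(S(n,k))=\dfrac{\sigma_p(k)-\sigma_p(B)}{p-1}$. -/

import Mathlib

open scoped Nat

/-- The power series `(e^t - 1) / t = ∑ t^m / (m + 1)!` over `ℚ`. -/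
noncomputable def expSubOneDivT : PowerSeries ℚ :=
  PowerSeries.mk fun m => 1 / ((m + 1)! : ℚ)

theorem X_mul_expSubOneDivT :
    PowerSeries.X * expSubOneDivT = PowerSeries.exp ℚ - 1 := by
  ext m
  cases m with
  | zero => simp [expSubOneDivT]
  | succ m =>
    rw [PowerSeries.coeff_succ_X_mul]
    simp [expSubOneDivT, PowerSeries.coeff_exp, PowerSeries.coeff_one]

theorem constantCoeff_expSubOneDivT : PowerSeries.constantCoeff expSubOneDivT = 1 := by
  simp [expSubOneDivT]

/-- The power series `(t / (e^t - 1))^l` over `ℚ`, for an integer exponent `l`. Since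
`(e^t - 1) / t` has constant term `1`, its inverse below is a genuine one. -/
noncomputable def bernoulliGenPow : ℤ → PowerSeries ℚ
  | Int.ofNat l => (expSubOneDivT⁻¹) ^ l
  | Int.negSucc l => expSubOneDivT ^ (l + 1)

/-- The higher order Bernoulli polynomial `B_m^{(l)}(x)` of degree `m` and order `l ∈ ℤ`:
`(t / (e^t - 1))^l * e^{t x} = ∑ B_m^{(l)}(x) t^m / m!` in `ℚ[x]⟦t⟧`. The second factor is
`e^{t x}`, obtained from `e^t` by the substitution `t ↦ x t`. -/
noncomputable def higherBernoulli (l : ℤ) (m : ℕ) : Polynomial ℚ :=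
  (m ! : ℚ) • PowerSeries.coeff m
    (PowerSeries.map (Polynomial.C : ℚ →+* Polynomial ℚ) (bernoulliGenPow l) *
      PowerSeries.rescale (Polynomial.X : Polynomial ℚ) (PowerSeries.exp (Polynomial ℚ)))

/-- A rational number `a` has a pole of order `M` (at `p`) if `ν_p(a) = -M`. -/
def HasPoleOfOrder (p : ℕ) (a : ℚ) (M : ℕ) : Prop :=
  a ≠ 0 ∧ padicValRat p a = -(M : ℤ)

/-- The maximum pole of a rational polynomial: the exponent of the highest power of `p` that
divides the denominator of one of its coefficients. -/
noncomputable def maxPole (p : ℕ) (f : Polynomial ℚ) : ℕ :=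
  f.support.sup fun i => padicValNat p (f.coeff i).den

/-- Reading `f` from the highest degree down, a pole of order `M` first occurs in degree `d`. -/
def FirstPoleInDegree (p : ℕ) (f : Polynomial ℚ) (M d : ℕ) : Prop :=
  IsGreatest {i : ℕ | HasPoleOfOrder p (f.coeff i) M} d

/-- The sum of the base `p` digits of `m`. -/
def digitSum (p m : ℕ) : ℕ := (p.digits m).sum

/-- `B` is a bottom segment of `n = ∑ n_i p^i` (base `p`): `B = ∑_{i < b} n_i p^i + c p^b` with
`0 ≤ c ≤ n_b`. Here `n % p ^ b` is `∑_{i < b} n_i p^i` and `n / p ^ b % p` is the digit `n_b`. -/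
def IsBottomSegment (p n B : ℕ) : Prop :=
  ∃ b c : ℕ, c ≤ n / p ^ b % p ∧ B = n % p ^ b + c * p ^ b

/-- For `1 ≤ k ≤ n`, the Stirling number `S(n, k)` is an almost minimum zero case: the estimate
`ν_p(S(n, k)) ≥ ν_p(n.choose k) - M`, with `M` the maximum pole of `B_{n-k}^{(-k)}(x)`, is
sharp. -/
def IsAMZC (p n k : ℕ) : Prop :=
  (padicValNat p (Nat.stirlingSecond n k) : ℤ) =
    (padicValNat p (n.choose k) : ℤ) - (maxPole p (higherBernoulli (-(k : ℤ)) (n - k)) : ℤ)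

/-! ### Base `p` digit sums: Legendre, Kummer and carries. -/

section DigitSum

variable {p : ℕ}

/-! Write `n = r + p^b (c + q)`, `B = r + p^b c = k + (p-1) u` and `m = n - k = (p-1) u + p^b q`.
The substitution `t = log (1 + w)` in the residue defining `B_m^{(-k)}` expands it in falling
factorials of `x - 1`; the one of degree `m - j` gets the coefficient `m!/(m-j)! * [w^j] (log (1+w)
/ w)^(-(n+1))` (`higherBernoulli_eq`). These falling factorials are monic over the integers, so all
poles come from the scalars.

The binomial and multinomial theorems split each scalar into monomials indexed by exponent vectors.
By Legendre and Kummer, `p - 1` times the valuation of a monomial is a combination of digit sums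
(`sub_one_mul_padicValRat_logMonomial`). The inequality `digitSum_add_sum_le` then says that no
monomial has a pole of order above `poleOrder p u`.

For (a), the inequality is strict for weights `j < (p-1) u`. At `j = (p-1) u` only the monomial of
`(w^(p-1))^u` gives equality, because adding `u` to `n` produces no carry. Hence the maximal pole
first occurs in degree `m - (p-1) u = n - B`.

For (b), `q = (p-1) f`, and `S(n, k)` is `n.choose k` times the constant coefficient, in which the
falling factorials become `± (m-j)!`. Only the pure monomial of full weight `m` keeps the maximal
pole: the other terms are strictly smaller by `digitSum_add_sum_lt` if `m - j < p`, and because `p`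
divides `(m-j)!` otherwise. Kummer's theorem for `n.choose k` gives the value. -/

theorem digitSum_zero : digitSum p 0 = 0 := by simp [digitSum]

theorem digitSum_le_self (x : ℕ) : digitSum p x ≤ x := Nat.digit_sum_le p x

variable [hp : Fact p.Prime]

/-- Legendre's formula, without subtraction. -/
theorem sub_one_mul_padicValNat_factorial_add_digitSum (x : ℕ) :
    (p - 1) * padicValNat p x ! + digitSum p x = x := by
  rw [sub_one_mul_padicValNat_factorial]
  exact Nat.sub_add_cancel (digitSum_le_self x)

theorem digitSum_eq_mod_add_div (x : ℕ) : digitSum p x = x % p + digitSum p (x / p) := by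
  rcases Nat.eq_zero_or_pos x with rfl | hx
  · simp [digitSum]
  · simp [digitSum, Nat.digits_def' hp.out.one_lt hx]

theorem digitSum_of_lt {x : ℕ} (hx : x < p) : digitSum p x = x := by
  rw [digitSum_eq_mod_add_div, Nat.mod_eq_of_lt hx, Nat.div_eq_of_lt hx, digitSum_zero, add_zero]

theorem digitSum_add_mul {a : ℕ} (ha : a < p) (q : ℕ) :
    digitSum p (a + p * q) = a + digitSum p q := by
  rw [digitSum_eq_mod_add_div, Nat.add_mul_mod_self_left, Nat.mod_eq_of_lt ha,
    Nat.add_mul_div_left _ _ hp.out.pos, Nat.div_eq_of_lt ha, zero_add]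

theorem digitSum_mul (q : ℕ) : digitSum p (p * q) = digitSum p q := by
  simpa using digitSum_add_mul hp.out.pos q

theorem digitSum_add_pow_mul {a b : ℕ} (ha : a < p ^ b) (q : ℕ) :
    digitSum p (a + p ^ b * q) = digitSum p a + digitSum p q := by
  induction b generalizing a with
  | zero =>
    obtain rfl : a = 0 := by simpa using ha
    simp [digitSum_zero]
  | succ b ih =>
    have h : a + p ^ (b + 1) * q = a % p + p * (a / p + p ^ b * q) := by
      conv_lhs => rw [← Nat.mod_add_div a p]
      ring
    rw [h, digitSum_add_mul (Nat.mod_lt _ hp.out.pos),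
      ih (Nat.div_lt_of_lt_mul (by rwa [pow_succ, mul_comm] at ha)), ← add_assoc,
      ← digitSum_eq_mod_add_div]

theorem digitSum_pow_mul (b q : ℕ) : digitSum p (p ^ b * q) = digitSum p q := by
  simpa [digitSum_zero] using digitSum_add_pow_mul (pow_pos hp.out.pos b) q

/-- Kummer's theorem, in terms of digit sums. -/
theorem digitSum_add_digitSum (x y : ℕ) :
    digitSum p x + digitSum p y =
      digitSum p (x + y) + (p - 1) * padicValNat p ((x + y).choose x) := by
  have h := congrArg (padicValNat p) (Nat.choose_mul_factorial_mul_factorial (Nat.le_add_right x y))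
  rw [Nat.add_sub_cancel_left] at h
  rw [padicValNat.mul (mul_ne_zero (Nat.choose_pos (by omega)).ne' (Nat.factorial_ne_zero _))
    (Nat.factorial_ne_zero _), padicValNat.mul (Nat.choose_pos (by omega)).ne'
    (Nat.factorial_ne_zero _)] at h
  have h1 := sub_one_mul_padicValNat_factorial_add_digitSum (p := p) x
  have h2 := sub_one_mul_padicValNat_factorial_add_digitSum (p := p) y
  have h3 := sub_one_mul_padicValNat_factorial_add_digitSum (p := p) (x + y)
  rw [← h, mul_add, mul_add] at h3
  omega

theorem digitSum_add_le (x y : ℕ) : digitSum p (x + y) ≤ digitSum p x + digitSum p y := by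
  rw [digitSum_add_digitSum]; exact Nat.le_add_right _ _

theorem digitSum_add_of_not_dvd_choose {x y : ℕ} (h : ¬ p ∣ (x + y).choose x) :
    digitSum p (x + y) = digitSum p x + digitSum p y := by
  rw [digitSum_add_digitSum, padicValNat.eq_zero_of_not_dvd h, mul_zero, add_zero]

theorem digitSum_sum_le {ι : Type*} (s : Finset ι) (f : ι → ℕ) :
    digitSum p (∑ i ∈ s, f i) ≤ ∑ i ∈ s, digitSum p (f i) := by
  classical
  induction s using Finset.induction_on with
  | empty => simp [digitSum_zero]
  | insert a s ha ih =>
    rw [Finset.sum_insert ha, Finset.sum_insert ha]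
    exact (digitSum_add_le _ _).trans (Nat.add_le_add_left ih _)

/-- A carry out of the lowest `b` digits makes the digit sum drop. -/
theorem digitSum_add_lt_of_pow_le {x y b : ℕ} (hx : x < p ^ b) (hy : y < p ^ b)
    (h : p ^ b ≤ x + y) : digitSum p (x + y) < digitSum p x + digitSum p y := by
  have hp1 := hp.out.one_lt
  have hb : b ≠ 0 := by rintro rfl; simp at hx hy h; omega
  have hv : 1 ≤ padicValNat p ((x + y).choose x) := by
    rw [add_comm x y, padicValNat_choose' (lt_add_one (Nat.log p (y + x)))]
    rw [Nat.one_le_iff_ne_zero, ← Nat.pos_iff_ne_zero, Finset.card_pos]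
    refine ⟨b, ?_⟩
    rw [Finset.mem_filter, Finset.mem_Ico, Nat.mod_eq_of_lt hx, Nat.mod_eq_of_lt hy]
    refine ⟨⟨by omega, ?_⟩, h⟩
    rw [Nat.lt_add_one_iff]
    exact Nat.le_log_of_pow_le hp1 (by omega)
  have := digitSum_add_digitSum (p := p) x y
  have h2 : 1 ≤ (p - 1) * padicValNat p ((x + y).choose x) :=
    Nat.mul_pos (by omega) hv
  omega

theorem digitSum_modEq (x : ℕ) : digitSum p x ≡ x [MOD p - 1] := by
  conv_rhs => rw [← sub_one_mul_padicValNat_factorial_add_digitSum (p := p) x]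
  simp [Nat.ModEq]

/-- Legendre's formula: `p` divides `x!` as soon as `x ≥ p`. This turns tight digit sum estimates
into size bounds. -/
theorem lt_of_digitSum_eq_self {x : ℕ} (h : digitSum p x = x) : x < p := by
  by_contra! hx
  have h1 := sub_one_mul_padicValNat_factorial_add_digitSum (p := p) x
  have h2 : 1 ≤ padicValNat p x ! :=
    one_le_padicValNat_of_dvd (Nat.factorial_ne_zero _) ((hp.out.dvd_factorial).2 hx)
  have h3 : 1 ≤ (p - 1) * padicValNat p x ! := Nat.mul_pos (by have := hp.out.one_lt; omega) h2
  omega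

theorem digitSum_pos {x : ℕ} (hx : 0 < x) : 0 < digitSum p x := by
  induction x using Nat.strong_induction_on with
  | _ x ih =>
    rw [digitSum_eq_mod_add_div]
    by_cases h : x % p = 0
    · have hd : p ∣ x := Nat.dvd_of_mod_eq_zero h
      have := ih (x / p) (Nat.div_lt_self hx hp.out.one_lt)
        (Nat.div_pos (Nat.le_of_dvd hx hd) hp.out.pos)
      omega
    · omega

end DigitSum

/-! ### The cost of a factor `w^i / (i + 1)` of the logarithm series. -/

/-- The amount by which `i` exceeds `(p - 1) * ν_p(i + 1)`. -/
def logSlack (p i : ℕ) : ℕ := i - (p - 1) * padicValNat p (i + 1)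

section LogSlack

variable {p : ℕ} [hp : Fact p.Prime]

theorem padicValNat_lt_self {r : ℕ} (hr : 0 < r) : padicValNat p r < r :=
  (Nat.lt_pow_self hp.out.one_lt).trans_le
    (Nat.le_of_dvd hr pow_padicValNat_dvd)

/-- Such an index is `p - 1` plus `p * (i / p)`: its factor counts as one pure factor `w^(p-1)` with
leftover weight `p * (i / p)`. -/
theorem exists_eq_of_dvd_succ {i : ℕ} (h : p ∣ i + 1) :
    ∃ r, i + 1 = p * (r + 1) ∧ i / p = r ∧ i = p - 1 + p * r ∧
      padicValNat p (i + 1) = 1 + padicValNat p (r + 1) := by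
  obtain ⟨r, hr⟩ := h
  have hp1 := hp.out.one_lt
  obtain ⟨r, rfl⟩ : ∃ r', r = r' + 1 := Nat.exists_eq_succ_of_ne_zero (by rintro rfl; simp at hr)
  have hi : i = p - 1 + p * r := by rw [mul_add] at hr; omega
  refine ⟨r, hr, ?_, hi, ?_⟩
  · rw [hi, Nat.add_mul_div_left _ _ hp.out.pos, Nat.div_eq_of_lt (by omega), zero_add]
  · rw [hr, padicValNat.mul hp.out.ne_zero (by omega), padicValNat_self]

theorem div_add_le_of_dvd_succ {i : ℕ} (h : p ∣ i + 1) :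
    i / p + (p - 1) * padicValNat p (i + 1) ≤ i := by
  obtain ⟨r, -, h2, h3, h4⟩ := exists_eq_of_dvd_succ h
  rw [h2, h4]
  obtain ⟨a, ha⟩ : ∃ a, p = a + 1 := ⟨p - 1, by have := hp.out.one_lt; omega⟩
  have h5 : padicValNat p (r + 1) < r + 1 := padicValNat_lt_self (Nat.succ_pos r)
  have h6 : (p - 1) * (1 + padicValNat p (r + 1)) ≤ (p - 1) * (1 + r) :=
    Nat.mul_le_mul_left _ (by omega)
  have h7 : i = (p - 1) * (1 + r) + r := by rw [h3, ha]; simp; ring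
  omega

theorem sub_one_mul_padicValNat_succ_le (i : ℕ) : (p - 1) * padicValNat p (i + 1) ≤ i := by
  by_cases h : p ∣ i + 1
  · exact le_trans (Nat.le_add_left _ _) (div_add_le_of_dvd_succ h)
  · simp [padicValNat.eq_zero_of_not_dvd h]

theorem logSlack_add (i : ℕ) : logSlack p i + (p - 1) * padicValNat p (i + 1) = i :=
  Nat.sub_add_cancel (sub_one_mul_padicValNat_succ_le i)

omit hp in
theorem logSlack_of_not_dvd {i : ℕ} (h : ¬ p ∣ i + 1) : logSlack p i = i := by
  simp [logSlack, padicValNat.eq_zero_of_not_dvd h]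

/-- The slack pays for the leftover weight `p * (i / p)`, whose digit sum is at most `i / p`. -/
theorem div_le_logSlack {i : ℕ} (h : p ∣ i + 1) : i / p ≤ logSlack p i := by
  have := div_add_le_of_dvd_succ h
  unfold logSlack; omega

/-- The prime 2 is a true exception: for `i = 3` both sides are 1. -/
theorem div_lt_logSlack {i : ℕ} (hp2 : p ≠ 2) (h : p ∣ i + 1) (hi : 0 < i / p) :
    i / p < logSlack p i := by
  obtain ⟨r, -, h2, h3, h4⟩ := exists_eq_of_dvd_succ h
  have hp3 : 3 ≤ p := by have := hp.out.two_le; omega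
  obtain ⟨a, ha⟩ : ∃ a, p = a + 1 := ⟨p - 1, by omega⟩
  have h5 : padicValNat p (r + 1) < r := by
    rw [h2] at hi
    have h8 : p ^ padicValNat p (r + 1) ≤ r + 1 := Nat.le_of_dvd (by omega) pow_padicValNat_dvd
    rcases Nat.eq_zero_or_pos (padicValNat p (r + 1)) with h0 | h0
    · omega
    · obtain ⟨v, hv⟩ : ∃ v, padicValNat p (r + 1) = v + 1 := ⟨_, (Nat.sub_add_cancel h0).symm⟩
      rw [hv, pow_succ] at h8
      have h9 : v < p ^ v := Nat.lt_pow_self hp.out.one_lt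
      nlinarith
  have h6 : (p - 1) * (1 + padicValNat p (r + 1)) ≤ (p - 1) * r :=
    Nat.mul_le_mul_left _ (by omega)
  have h7 : i = (p - 1) * r + (p - 1) + r := by rw [h3, ha]; simp; ring
  rw [← h4] at h6
  unfold logSlack
  omega

theorem logSlack_pos {i : ℕ} (hi : 0 < i) (hne : i ≠ p - 1) : 0 < logSlack p i := by
  by_cases h : p ∣ i + 1
  · obtain ⟨r, -, h2, h3, -⟩ := exists_eq_of_dvd_succ h
    have := div_le_logSlack h
    have : r ≠ 0 := by rintro rfl; simp at h3; exact hne h3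
    omega
  · rwa [logSlack_of_not_dvd h]

theorem logSlack_sub_one : logSlack p (p - 1) = 0 := by
  simp [logSlack, Nat.sub_add_cancel hp.out.one_lt.le]

end LogSlack

/-! ### The digit sum inequality for pure powers of `w^(p-1)`. -/

section Split

variable {p : ℕ} [hp : Fact p.Prime] {b c r q u d Z : ℕ}

/-- With `e`, `E` and `ρ`, `X` the low and high parts of `d` and `Z`, comparing `h` above `p^b`
gives `c + q + E = y + X + p E` with `y ≤ c + digitSum p ρ`. The factor `p` does not change the
digit sum of `E`. -/
theorem digitSum_high_le (hc : c + 2 ≤ p) (hu : (p - 1) * u < p ^ b * (c + 1))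
    (h : (p - 1) * u + p ^ b * q = (p - 1) * d + Z) :
    digitSum p (c + q + d / p ^ b) ≤ c + digitSum p (d / p ^ b) + digitSum p Z := by
  have hpb : 0 < p ^ b := pow_pos hp.out.pos b
  obtain ⟨a, ha⟩ : ∃ a, p - 1 = a := ⟨_, rfl⟩
  have hpa : p = a + 1 := by have := hp.out.one_lt; omega
  rw [ha] at h hu
  have hd := Nat.mod_add_div d (p ^ b)
  have hZ := Nat.mod_add_div Z (p ^ b)
  set E := d / p ^ b
  set e := d % p ^ b
  set X := Z / p ^ b
  set ρ := Z % p ^ b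
  have hρ : ρ < p ^ b := Nat.mod_lt _ hpb
  have he : e < p ^ b := Nat.mod_lt _ hpb
  have hsZ : digitSum p Z = digitSum p ρ + digitSum p X := by
    rw [← hZ, digitSum_add_pow_mul hρ]
  have hX : X = Z / p ^ b := rfl
  clear_value X ρ E e
  have key : ∀ y, c + q + E = y + (X + p * E) → 
      digitSum p (c + q + E) ≤ y + (digitSum p X + digitSum p E) := by
    intro y hy
    rw [hy]
    refine (digitSum_add_le _ _).trans (Nat.add_le_add (digitSum_le_self y) ?_)
    refine (digitSum_add_le _ _).trans ?_
    rw [digitSum_mul]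
  rcases le_or_gt e u with heu | heu
  · obtain ⟨δ, rfl⟩ := Nat.exists_eq_add_of_le heu
    have h1 : a * δ + p ^ b * q = Z + p ^ b * (a * E) := by
      rw [← hd] at h; linarith
    have h2 := Nat.mod_add_div (a * δ) (p ^ b)
    have ht : a * δ / p ^ b < c + 1 := by
      refine Nat.div_lt_of_lt_mul (lt_of_le_of_lt ?_ hu)
      exact Nat.mul_le_mul_left _ (by omega)
    have h3 : (a * δ + p ^ b * q) / p ^ b = a * δ / p ^ b + q :=
      Nat.add_mul_div_left _ _ hpb
    rw [h1, Nat.add_mul_div_left _ _ hpb, ← hX] at h3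
    obtain ⟨t, h_t⟩ : ∃ t, t = a * δ / p ^ b := ⟨_, rfl⟩
    rw [← h_t] at ht h2 h3
    have hpE : p * E = a * E + E := by nth_rewrite 1 [hpa]; ring
    have := key (c - t) (by omega)
    omega
  · obtain ⟨g, hg⟩ := Nat.exists_eq_add_of_lt heu
    rw [hg] at hd he
    have h1 : p ^ b * q = (a * (g + 1) + ρ) + p ^ b * (X + a * E) := by
      rw [← hd, ← hZ] at h; linarith
    have h2 : p ^ b ∣ a * (g + 1) + ρ :=
      (Nat.dvd_add_left (Dvd.intro _ rfl)).1 (h1 ▸ Dvd.intro _ rfl)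
    obtain ⟨t, ht⟩ := h2
    rw [ht, ← mul_add] at h1
    have h3 : q = t + (X + a * E) := Nat.eq_of_mul_eq_mul_left hpb h1
    have ha0 : 0 < a := by omega
    have htp : t < p := by
      by_contra! hcon
      have h5 : p ^ b * p ≤ p ^ b * t := Nat.mul_le_mul_left _ hcon
      have h4 : a * (g + 1) ≤ a * p ^ b := Nat.mul_le_mul_left _ (by omega)
      rw [← ht] at h5
      have h6 : p ^ b * p = a * p ^ b + p ^ b := by
        conv_lhs => rw [mul_comm]
        conv_lhs => enter [1]; rw [hpa]
        ring
      omega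
    have ht0 : 0 < t := by
      rcases Nat.eq_zero_or_pos t with rfl | h0
      · rw [mul_zero] at ht
        have : 0 < a * (g + 1) := Nat.mul_pos ha0 (Nat.succ_pos g)
        omega
      · exact h0
    have hmod : digitSum p ρ ≡ t [MOD a] := by
      have e1 : digitSum p ρ ≡ ρ [MOD a] := ha ▸ digitSum_modEq ρ
      have e2 : p ^ b * t ≡ 1 ^ b * t [MOD a] := by
        refine Nat.ModEq.mul_right _ (Nat.ModEq.pow _ ?_)
        rw [hpa]; simp [Nat.ModEq]
      rw [one_pow, one_mul, ← ht] at e2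
      refine e1.trans (Nat.ModEq.trans ?_ e2)
      simp [Nat.ModEq]
    -- The two are congruent modulo `p - 1` and `0 < t < p`, so failure forces `ρ = 0` and `t = p -
    -- 1`. Then `g + 1 = p^b`, against `g + 1 ≤ e < p^b`.
    have hle : t ≤ digitSum p ρ := by
      by_contra! hlt
      have hdv : a ∣ t - digitSum p ρ := (Nat.modEq_iff_dvd' hlt.le).1 hmod
      have hle' := Nat.le_of_dvd (by omega) hdv
      have hs0 : digitSum p ρ = 0 := by omega
      have hρ0 : ρ = 0 := by
        by_contra hne
        have := digitSum_pos (p := p) (Nat.pos_of_ne_zero hne)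
        omega
      have hta : t = a := by omega
      rw [hρ0, hta, add_zero, mul_comm] at ht
      have := Nat.eq_of_mul_eq_mul_right ha0 ht
      omega
    have := key (c + t) (by rw [h3, hpa]; ring)
    omega

theorem digitSum_add_split_le (r n d b : ℕ) :
    digitSum p (r + p ^ b * n + d) ≤ digitSum p (r + d % p ^ b) + digitSum p (n + d / p ^ b) := by
  have : r + p ^ b * n + d = (r + d % p ^ b) + p ^ b * (n + d / p ^ b) := by
    conv_lhs => rw [← Nat.mod_add_div d (p ^ b)]
    ring
  rw [this]
  refine (digitSum_add_le _ _).trans ?_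
  rw [digitSum_pow_mul]

theorem digitSum_eq_mod_add_div_pow (d b : ℕ) :
    digitSum p d = digitSum p (d % p ^ b) + digitSum p (d / p ^ b) := by
  conv_lhs => rw [← Nat.mod_add_div d (p ^ b)]
  exact digitSum_add_pow_mul (Nat.mod_lt _ (pow_pos hp.out.pos b)) _

theorem digitSum_pure_le (hc : c + 2 ≤ p) (r : ℕ) (hu : (p - 1) * u < p ^ b * (c + 1))
    (h : (p - 1) * u + p ^ b * q = (p - 1) * d + Z) :
    digitSum p (r + p ^ b * (c + q) + d) ≤
      digitSum p r + c + digitSum p d + digitSum p Z := by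
  have h1 := digitSum_high_le hc hu h
  have h2 := digitSum_add_split_le (p := p) r (c + q) d b
  have h3 := digitSum_add_le (p := p) r (d % p ^ b)
  have h4 := digitSum_eq_mod_add_div_pow (p := p) d b
  omega

theorem digitSum_pure_lt_of_carry (hc : c + 2 ≤ p) (hr : r < p ^ b)
    (hu : (p - 1) * u < p ^ b * (c + 1))
    (h : (p - 1) * u + p ^ b * q = (p - 1) * d + Z) (hcarry : p ^ b ≤ r + d % p ^ b) :
    digitSum p (r + p ^ b * (c + q) + d) <
      digitSum p r + c + digitSum p d + digitSum p Z := by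
  have h1 := digitSum_high_le hc hu h
  have h2 := digitSum_add_split_le (p := p) r (c + q) d b
  have h3 := digitSum_add_lt_of_pow_le hr (Nat.mod_lt d (pow_pos hp.out.pos b)) hcarry
  have h4 := digitSum_eq_mod_add_div_pow (p := p) d b
  omega

theorem add_lt_of_digitSum_add_eq (hr : r < p ^ b) (hu : u < p ^ b)
    (h : digitSum p (r + u) = digitSum p r + digitSum p u) : r + u < p ^ b := by
  by_contra! hle
  have := digitSum_add_lt_of_pow_le hr hu hle
  omega

/-- Here `j` pure factors are missing from the full count `u + p^b f`. If `j ≤ u`, the low digits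
stay carry-free and the digit sum of the remainder is a pure loss. If `u < j ≤ r + u`, the borrow in
`d` makes `r + d` carry past `p^b`. Only small explicit configurations remain. -/
theorem digitSum_pure_lt {f j : ℕ} (hc : c + 2 ≤ p) (hr : r < p ^ b) (hub : u < p ^ b)
    (hu : (p - 1) * u < p ^ b * (c + 1)) (hru : digitSum p (r + u) = digitSum p r + digitSum p u)
    (hpos : 0 < r + c) (hj : 0 < j) (hd : d + j = u + p ^ b * f)
    (hjp : j = 1 ∨ p = 2 ∧ (j = 3 ∨ j = 2 ∧ d % 2 = 1)) :
    digitSum p (r + p ^ b * (c + (p - 1) * f) + d) <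
      digitSum p r + c + digitSum p d + digitSum p ((p - 1) * j) := by
  have hpb : 0 < p ^ b := pow_pos hp.out.pos b
  have hp1 := hp.out.one_lt
  have hru' := add_lt_of_digitSum_add_eq hr hub hru
  have hcf : ∀ x < p, ∀ f, digitSum p (x + p * f) = x + digitSum p f :=
    fun x hx f => digitSum_add_mul hx f
  obtain ⟨a, ha⟩ : ∃ a, p - 1 = a := ⟨_, rfl⟩
  have hpa : p = a + 1 := by omega
  have heq : (p - 1) * u + p ^ b * ((p - 1) * f) = (p - 1) * d + (p - 1) * j := by
    rw [← mul_add, hd]; ring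
  have hsZ : 0 < digitSum p ((p - 1) * j) := digitSum_pos (Nat.mul_pos (by omega) hj)
  rcases le_or_gt j u with hju | hju
  · obtain ⟨v, rfl⟩ := Nat.exists_eq_add_of_le hju
    obtain rfl : d = v + p ^ b * f := by omega
    have e1 : r + p ^ b * (c + (p - 1) * f) + (v + p ^ b * f)
        = (r + v) + p ^ b * (c + p * f) := by
      rw [ha]; nth_rewrite 4 [hpa]; ring
    rw [e1, digitSum_add_pow_mul (by omega), hcf c (by omega), digitSum_add_pow_mul (by omega)]
    have := digitSum_add_le (p := p) r v
    omega
  obtain ⟨f, rfl⟩ : ∃ f', f = f' + 1 := by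
    refine Nat.exists_eq_succ_of_ne_zero ?_
    rintro rfl
    omega
  rcases le_or_gt j (r + u) with hjr | hjr
  · refine digitSum_pure_lt_of_carry hc hr hu heq ?_
    have e1 : d = (u + p ^ b - j) + p ^ b * f := by rw [mul_add] at hd; omega
    rw [e1, Nat.add_mul_mod_self_left, Nat.mod_eq_of_lt (by omega)]
    omega
  rcases hjp with rfl | ⟨rfl, hj3⟩
  · obtain ⟨rfl, rfl⟩ : r = 0 ∧ u = 0 := by omega
    have e1 : d = (p ^ b - 1) + p ^ b * f := by rw [mul_add] at hd; omega
    have e2 : 0 + p ^ b * (c + (p - 1) * (f + 1)) + d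
        = (p ^ b - 1) + p ^ b * ((c - 1) + p * (f + 1)) := by
      obtain ⟨c, rfl⟩ : ∃ c', c = c' + 1 := ⟨c - 1, by omega⟩
      rw [e1, ha, Nat.add_sub_cancel]
      obtain ⟨y, hy⟩ : ∃ y, p ^ b = y + 1 := ⟨p ^ b - 1, by omega⟩
      have e3 : p * (f + 1) = a * (f + 1) + (f + 1) := by
        nth_rewrite 1 [hpa]; ring
      rw [e3, hy, Nat.add_sub_cancel]
      ring
    rw [e2, e1, digitSum_add_pow_mul (by omega), digitSum_add_pow_mul (by omega),
      hcf (c - 1) (by omega), mul_one, digitSum_of_lt (p := p) (x := p - 1) (by omega)]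
    have h1 := digitSum_add_le (p := p) f 1
    rw [digitSum_of_lt (p := p) hp1] at h1
    omega
  · obtain rfl : c = 0 := by omega
    have hb : b ≠ 0 := by rintro rfl; simp at hr hub; omega
    obtain ⟨y, hy⟩ : ∃ y, 2 ^ b = 2 * y := by
      obtain ⟨b, rfl⟩ := Nat.exists_eq_succ_of_ne_zero hb
      exact ⟨2 ^ b, by rw [pow_succ, mul_comm]⟩
    have hT : 2 ^ b * (f + 1) = 2 * (y * (f + 1)) := by rw [hy, mul_assoc]
    have d0 : digitSum 2 0 = 0 := digitSum_zero
    have d1 : digitSum 2 1 = 1 := digitSum_of_lt hp1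
    have dd : ∀ x, digitSum 2 (2 * x) = digitSum 2 x := digitSum_mul
    have dd1 : ∀ x, digitSum 2 (1 + 2 * x) = 1 + digitSum 2 x := digitSum_add_mul hp1
    have d2 : digitSum 2 2 = 1 := (dd 1).trans d1
    have d3 : digitSum 2 3 = 2 := by rw [show 3 = 1 + 2 * 1 from rfl, dd1, d1]
    have ds : ∀ x, digitSum 2 (x + 1) ≤ digitSum 2 x + 1 := by
      intro x
      have := digitSum_add_le (p := 2) x 1
      omega
    set t := y * (f + 1)
    have hne : ¬ (r = 1 ∧ u = 1) := by
      rintro ⟨rfl, rfl⟩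
      simp only [Nat.reduceAdd, d1, d2] at hru
      omega
    have hu0 : u = 0 := by omega
    subst hu0
    rcases hj3 with rfl | ⟨rfl, hodd⟩
    · have ht2 : 2 ≤ t := by omega
      obtain ⟨t, h_t⟩ : ∃ t', t = t' + 2 := ⟨t - 2, by omega⟩
      have hd' : d = 1 + 2 * t := by omega
      have hmul : 2 ^ b * (0 + (2 - 1) * (f + 1)) = 2 * t + 4 := by
        rw [zero_add, show 2 - 1 = 1 from rfl, one_mul, hT]; omega
      rw [hmul, show (2 - 1) * 3 = 3 from rfl, d3, hd', dd1]
      have hr12 : r = 1 ∨ r = 2 := by omega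
      have hs1 := ds t
      rcases hr12 with rfl | rfl
      · rw [show 1 + (2 * t + 4) + (1 + 2 * t) = 2 * (1 + 2 * (t + 1)) by ring, dd, dd1]
        omega
      · rw [show 2 + (2 * t + 4) + (1 + 2 * t) = 1 + 2 * (1 + 2 * (t + 1)) by ring, dd1, dd1]
        omega
    -- For `j = 2` one has `u = 0`, and `d + 2 = 2 t` contradicts the oddness of `d`.
    · omega

end Split

/-! ### The digit sum inequality for arbitrary exponent vectors. -/

section Weights

variable {p : ℕ} [hp : Fact p.Prime] {b c r q u Z : ℕ} {s : Finset ℕ} {a : ℕ → ℕ}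

theorem sum_mul_eq_of_dvd_succ :
    ∑ i ∈ s with p ∣ i + 1, i * a i =
      (p - 1) * ∑ i ∈ s with p ∣ i + 1, a i + p * ∑ i ∈ s with p ∣ i + 1, i / p * a i := by
  rw [Finset.mul_sum, Finset.mul_sum, ← Finset.sum_add_distrib]
  refine Finset.sum_congr rfl fun i hi => ?_
  obtain ⟨t, -, h2, h3, -⟩ := exists_eq_of_dvd_succ (Finset.mem_filter.1 hi).2
  rw [h2]
  nth_rewrite 1 [h3]
  ring

theorem sum_div_mul_le_sum_logSlack_mul :
    ∑ i ∈ s with p ∣ i + 1, i / p * a i ≤ ∑ i ∈ s with p ∣ i + 1, logSlack p i * a i :=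
  Finset.sum_le_sum fun _ hi =>
    Nat.mul_le_mul_right _ (div_le_logSlack (Finset.mem_filter.1 hi).2)

omit hp in
theorem sum_logSlack_mul_of_not_dvd_succ :
    ∑ i ∈ s with ¬ p ∣ i + 1, logSlack p i * a i = ∑ i ∈ s with ¬ p ∣ i + 1, i * a i :=
  Finset.sum_congr rfl fun _ hi => by rw [logSlack_of_not_dvd (Finset.mem_filter.1 hi).2]

/-- Reduction to the pure case: each index with `p ∣ i + 1` is replaced by `p - 1`, and all other
weight joins the remainder, which becomes `Z + z₀ + p * z₁`. The slacks pay for `z₀` and `z₁`, and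
subadditivity for the count `d₀`. -/
theorem digitSum_add_sum_le (hc : c + 2 ≤ p) (r : ℕ) (hu : (p - 1) * u < p ^ b * (c + 1))
    (h : ∑ i ∈ s, i * a i + Z = (p - 1) * u + p ^ b * q) :
    digitSum p (r + p ^ b * (c + q) + ∑ i ∈ s, a i) ≤
      digitSum p r + c + ∑ i ∈ s, digitSum p (a i) + ∑ i ∈ s, logSlack p i * a i +
        digitSum p Z := by
  rw [← Finset.sum_filter_add_sum_filter_not s (fun i => p ∣ i + 1) (fun i => i * a i),
    sum_mul_eq_of_dvd_succ] at h
  rw [← Finset.sum_filter_add_sum_filter_not s (fun i => p ∣ i + 1) a,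
    ← Finset.sum_filter_add_sum_filter_not s (fun i => p ∣ i + 1) (fun i => digitSum p (a i)),
    ← Finset.sum_filter_add_sum_filter_not s (fun i => p ∣ i + 1) (fun i => logSlack p i * a i),
    sum_logSlack_mul_of_not_dvd_succ]
  have h1 := digitSum_sum_le (p := p) {i ∈ s | p ∣ i + 1} a
  have h2 := digitSum_sum_le (p := p) {i ∈ s | ¬ p ∣ i + 1} a
  have h3 := sum_div_mul_le_sum_logSlack_mul (p := p) (s := s) (a := a)
  set d₁ := ∑ i ∈ s with p ∣ i + 1, a i
  set d₀ := ∑ i ∈ s with ¬ p ∣ i + 1, a i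
  set z₁ := ∑ i ∈ s with p ∣ i + 1, i / p * a i
  set z₀ := ∑ i ∈ s with ¬ p ∣ i + 1, i * a i
  have h4 : digitSum p (r + p ^ b * (c + q) + d₁) ≤
      digitSum p r + c + digitSum p d₁ + digitSum p (Z + z₀ + p * z₁) :=
    digitSum_pure_le hc r hu (by rw [← h]; ring)
  have h5 := digitSum_add_le (p := p) (r + p ^ b * (c + q) + d₁) d₀
  have h6 := digitSum_add_le (p := p) (Z + z₀) (p * z₁)
  have h7 := digitSum_add_le (p := p) Z z₀
  have h8 := digitSum_le_self (p := p) z₀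
  have h9 := digitSum_le_self (p := p) z₁
  rw [digitSum_mul] at h6
  rw [← add_assoc]
  omega

/-- The strict form: at a multiple of `p - 1`, only the monomial of the pure terms
`w ^ (p - 1)` of full weight reaches the minimal valuation. -/
theorem digitSum_add_sum_lt {f : ℕ} (hc : c + 2 ≤ p) (hr : r < p ^ b) (hub : u < p ^ b)
    (hu : (p - 1) * u < p ^ b * (c + 1)) (hru : digitSum p (r + u) = digitSum p r + digitSum p u)
    (hpos : 0 < r + c) (h : ∑ i ∈ s, i * a i + Z = (p - 1) * u + p ^ b * ((p - 1) * f))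
    (hZ : Z < p) (hne : Z = 0 → ∃ i ∈ s, i ≠ 0 ∧ i ≠ p - 1 ∧ a i ≠ 0) :
    digitSum p (r + p ^ b * (c + (p - 1) * f) + ∑ i ∈ s, a i) <
      digitSum p r + c + ∑ i ∈ s, digitSum p (a i) + ∑ i ∈ s, logSlack p i * a i +
        digitSum p Z := by
  -- Equality would make every estimate behind `digitSum_add_sum_le` tight.
  by_contra! hge
  rw [← Finset.sum_filter_add_sum_filter_not s (fun i => p ∣ i + 1) (fun i => i * a i),
    sum_mul_eq_of_dvd_succ] at h
  rw [← Finset.sum_filter_add_sum_filter_not s (fun i => p ∣ i + 1) a,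
    ← Finset.sum_filter_add_sum_filter_not s (fun i => p ∣ i + 1) (fun i => digitSum p (a i)),
    ← Finset.sum_filter_add_sum_filter_not s (fun i => p ∣ i + 1) (fun i => logSlack p i * a i),
    sum_logSlack_mul_of_not_dvd_succ] at hge
  have h1 := digitSum_sum_le (p := p) {i ∈ s | p ∣ i + 1} a
  have h2 := digitSum_sum_le (p := p) {i ∈ s | ¬ p ∣ i + 1} a
  have h3 := sum_div_mul_le_sum_logSlack_mul (p := p) (s := s) (a := a)
  obtain ⟨d₁, hd₁⟩ : ∃ x, x = ∑ i ∈ s with p ∣ i + 1, a i := ⟨_, rfl⟩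
  obtain ⟨d₀, hd₀⟩ : ∃ x, x = ∑ i ∈ s with ¬ p ∣ i + 1, a i := ⟨_, rfl⟩
  obtain ⟨z₁, hz₁⟩ : ∃ x, x = ∑ i ∈ s with p ∣ i + 1, i / p * a i := ⟨_, rfl⟩
  obtain ⟨z₀, hz₀⟩ : ∃ x, x = ∑ i ∈ s with ¬ p ∣ i + 1, i * a i := ⟨_, rfl⟩
  rw [← hd₁] at h h1 hge
  rw [← hd₀] at h2 hge
  rw [← hz₁] at h h3
  rw [← hz₀] at h hge
  have h4 : digitSum p (r + p ^ b * (c + (p - 1) * f) + d₁) ≤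
      digitSum p r + c + digitSum p d₁ + digitSum p (Z + z₀ + p * z₁) :=
    digitSum_pure_le hc r hu (by rw [← h]; ring)
  have h5 := digitSum_add_le (p := p) (r + p ^ b * (c + (p - 1) * f) + d₁) d₀
  rw [add_assoc (r + p ^ b * (c + (p - 1) * f))] at h5
  have h6 := digitSum_add_le (p := p) (Z + z₀) (p * z₁)
  have h7 := digitSum_add_le (p := p) Z z₀
  have h8 := digitSum_le_self (p := p) z₀
  have h9 := digitSum_le_self (p := p) z₁
  have h10 := digitSum_of_lt hZ
  rw [digitSum_mul] at h6
  have hp1 := hp.out.one_lt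
  have e_z₀ : z₀ < p := lt_of_digitSum_eq_self (by omega)
  have e_Z : Z + z₀ < p := lt_of_digitSum_eq_self (by rw [digitSum_of_lt e_z₀] at h7; omega)
  have e_slack : z₁ = ∑ i ∈ s with p ∣ i + 1, logSlack p i * a i := by omega
  have e_pure : digitSum p (r + p ^ b * (c + (p - 1) * f) + d₁) =
      digitSum p r + c + digitSum p d₁ + digitSum p (Z + z₀ + p * z₁) := by omega
  have e_z₁ : z₁ < p := lt_of_digitSum_eq_self (by omega)
  have e_d₁ : digitSum p d₁ = ∑ i ∈ s with p ∣ i + 1, digitSum p (a i) := by omega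
  clear hge h1 h2 h3 h4 h5 h6 h7 h8 h9 h10
  -- The enlarged remainder equals `j` missing pure factors, so `digitSum_pure_lt` contradicts
  -- `e_pure`.
  have key : ∀ j, Z + z₀ + p * z₁ = (p - 1) * j → 0 < j →
      (j = 1 ∨ p = 2 ∧ (j = 3 ∨ j = 2 ∧ d₁ % 2 = 1)) → False := by
    intro j hj hj0 hjp
    have hd : d₁ + j = u + p ^ b * f := by
      refine Nat.eq_of_mul_eq_mul_left (show 0 < p - 1 by omega) ?_
      rw [mul_add, ← hj, mul_add]
      rw [mul_left_comm] at h
      omega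
    have := digitSum_pure_lt hc hr hub hu hru hpos hj0 hd hjp
    rw [← hj, e_pure] at this
    omega
  have z₀_zero : z₀ = 0 → ∀ i ∈ s, ¬ p ∣ i + 1 → i ≠ 0 → a i = 0 := by
    intro hz i hi hdvd hi0
    have h1 := Finset.sum_eq_zero_iff.1 (hz₀.symm.trans hz) i (Finset.mem_filter.2 ⟨hi, hdvd⟩)
    exact (Nat.mul_eq_zero.1 h1).resolve_left hi0
  have z₁_zero : z₁ = 0 → ∀ i ∈ s, p ∣ i + 1 → i ≠ p - 1 → a i = 0 := by
    intro hz i hi hdvd hi0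
    have h1 := Finset.sum_eq_zero_iff.1 (hz₁.symm.trans hz) i (Finset.mem_filter.2 ⟨hi, hdvd⟩)
    refine (Nat.mul_eq_zero.1 h1).resolve_left ?_
    obtain ⟨t, -, h2, h3, -⟩ := exists_eq_of_dvd_succ hdvd
    rw [h2]
    rintro rfl
    simp at h3
    exact hi0 h3
  have hpos' : z₁ = 0 → 0 < Z + z₀ := by
    intro hz1
    by_contra! hle
    obtain ⟨i, hi, hi0, hip, hai⟩ := hne (by omega)
    by_cases hdvd : p ∣ i + 1
    · exact hai (z₁_zero hz1 i hi hdvd hip)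
    · exact hai (z₀_zero (by omega) i hi hdvd hi0)
  by_cases hp2 : p = 2
  · subst hp2
    -- For `p = 2` the indices in `z₀` are even, while `z₀ < 2`.
    have hz0 : z₀ = 0 := by
      by_contra hz
      have heven : 2 ∣ z₀ := by
        rw [hz₀]
        refine Finset.dvd_sum fun i hi => Dvd.dvd.mul_right ?_ _
        have := (Finset.mem_filter.1 hi).2
        omega
      have := Nat.le_of_dvd (Nat.pos_of_ne_zero hz) heven
      omega
    have hz1 : z₁ = 0 ∨ z₁ = 1 := by omega
    rcases hz1 with hz1 | hz1
    · have := hpos' hz1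
      exact key (Z + 2 * z₁) (by rw [hz0]; ring) (by omega) (by omega)
    -- One index with `i / 2 = 1` occurs, once; all other contributions to `d₁` come from index 1.
    -- Tightness forbids a carry in `1 + y`, so `1 + y` is odd.
    · have hodd : d₁ % 2 = 1 := by
        obtain ⟨i, hi, hi1⟩ : ∃ i ∈ ({i ∈ s | 2 ∣ i + 1} : Finset ℕ), i / 2 * a i ≠ 0 := by
          by_contra! hcon
          rw [Finset.sum_eq_zero hcon] at hz₁
          omega
        have hsplit := Finset.add_sum_erase _ (fun i => i / 2 * a i) hi
        rw [← hz₁, hz1] at hsplit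
        have hone : i / 2 * a i = 1 := by omega
        have hrest : ∑ x ∈ ({i ∈ s | 2 ∣ i + 1} : Finset ℕ).erase i, x / 2 * a x = 0 := by
          omega
        have hai : a i = 1 := Nat.eq_one_of_mul_eq_one_left hone
        have hzero : ∀ x ∈ ({i ∈ s | 2 ∣ i + 1} : Finset ℕ).erase i, x ≠ 1 → a x = 0 := by
          intro x hx hx1
          have h1 := Finset.sum_eq_zero_iff.1 hrest x hx
          refine (Nat.mul_eq_zero.1 h1).resolve_left ?_
          have := (Finset.mem_filter.1 (Finset.mem_of_mem_erase hx)).2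
          omega
        -- Quantifying over `g` lets the same `y` serve for the count and for the digit sums.
        have hsum : ∃ y, ∀ g : ℕ → ℕ, g 0 = 0 →
            ∑ x ∈ ({i ∈ s | 2 ∣ i + 1} : Finset ℕ).erase i, g (a x) = g y := by
          by_cases hmem : 1 ∈ ({i ∈ s | 2 ∣ i + 1} : Finset ℕ).erase i
          · refine ⟨a 1, fun g hg => Finset.sum_eq_single_of_mem 1 hmem fun x hx hx1 => ?_⟩
            rw [hzero x hx hx1, hg]
          · refine ⟨0, fun g hg => ?_⟩
            rw [hg]
            refine Finset.sum_eq_zero fun x hx => ?_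
            rw [hzero x hx (by rintro rfl; exact hmem hx), hg]
        obtain ⟨y, hy⟩ := hsum
        have hd : d₁ = 1 + y := by
          rw [hd₁, ← Finset.add_sum_erase _ a hi, hai]
          exact congrArg _ (hy (fun x => x) rfl)
        rw [← Finset.add_sum_erase _ (fun i => digitSum 2 (a i)) hi, hy _ digitSum_zero,
          hai, hd] at e_d₁
        rw [hd]
        have h1 : digitSum 2 1 = 1 := digitSum_of_lt (by omega)
        have := digitSum_add_digitSum (p := 2) 1 y
        rw [e_d₁, Nat.choose_one_right] at this
        by_contra hcon
        have h2 : 1 ≤ padicValNat 2 (1 + y) :=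
          one_le_padicValNat_of_dvd (by omega) (by omega)
        omega
      refine key (Z + 2 * z₁) (by rw [hz0]; ring) (by omega) (Or.inr ⟨rfl, ?_⟩)
      omega
  -- For odd `p` a nonzero `z₁` would leave unused slack. Then `Z + z₀` is a positive multiple of `p
  -- - 1` below `p`, so `j = 1`.
  · have hz1 : z₁ = 0 := by
      rw [hz₁]
      refine Finset.sum_eq_zero fun i hi => ?_
      by_contra hcon
      have hlt : ∑ i ∈ s with p ∣ i + 1, i / p * a i <
          ∑ i ∈ s with p ∣ i + 1, logSlack p i * a i := by
        refine Finset.sum_lt_sum (fun j hj => Nat.mul_le_mul_right _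
          (div_le_logSlack (Finset.mem_filter.1 hj).2)) ⟨i, hi, ?_⟩
        rw [Nat.mul_eq_zero] at hcon
        push Not at hcon
        exact Nat.mul_lt_mul_of_pos_right
          (div_lt_logSlack hp2 (Finset.mem_filter.1 hi).2 (Nat.pos_of_ne_zero hcon.1))
          (Nat.pos_of_ne_zero hcon.2)
      omega
    have hpz := hpos' hz1
    refine key 1 ?_ one_pos (Or.inl rfl)
    rw [hz1, mul_zero, add_zero] at h ⊢
    have hdvd : p - 1 ∣ Z + z₀ := by
      have h1 : p - 1 ∣ (p - 1) * d₁ + (Z + z₀) := by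
        have : (p - 1) * d₁ + (Z + z₀) = (p - 1) * (u + p ^ b * f) := by
          rw [mul_add, mul_left_comm]; omega
        exact this ▸ Dvd.intro _ rfl
      exact (Nat.dvd_add_right (Dvd.intro _ rfl)).1 h1
    rw [mul_one]
    have := Nat.le_of_dvd hpz hdvd
    omega

end Weights

/-! ### The substitution `t = log (1 + w)` and the falling factorial expansion. -/

/-- The power series `log (1 + w) / w = ∑ (-1)^i w^i / (i + 1)` over `ℚ`. -/
noncomputable def logDivX : PowerSeries ℚ :=
  PowerSeries.mk fun i => (-1) ^ i / ((i : ℚ) + 1)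

section Series

open PowerSeries

theorem X_mul_logDivX : X * logDivX = log ℚ := by
  ext m
  cases m with
  | zero => simp
  | succ m =>
    rw [coeff_succ_X_mul]
    simp [logDivX, pow_succ]

theorem constantCoeff_logDivX : constantCoeff logDivX = 1 := by
  simp [logDivX]

theorem logDivX_mul_inv : logDivX * logDivX⁻¹ = 1 :=
  PowerSeries.mul_inv_cancel _ (by simp [constantCoeff_logDivX])

theorem hasSubst_log : HasSubst (log ℚ) := HasSubst.log

theorem one_add_X_mul_derivative_log : (1 + X) * d⁄dX ℚ (log ℚ) = 1 := by
  rw [deriv_log]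
  ext m
  cases m with
  | zero => simp
  | succ m => simp [add_mul, coeff_succ_X_mul, coeff_one, pow_succ]

/-- The product of the left side with `D = 1 / (1 + X)` has derivative zero and constant term 1. -/
theorem exp_subst_log : (exp ℚ).subst (log ℚ) = 1 + X := by
  have h1 := one_add_X_mul_derivative_log
  set D := d⁄dX ℚ (log ℚ)
  have hE : d⁄dX ℚ ((exp ℚ).subst (log ℚ)) = (exp ℚ).subst (log ℚ) * D := by
    rw [derivative_subst hasSubst_log, derivative_exp]
  have hD : d⁄dX ℚ D = -D ^ 2 := by
    have h2 := congrArg (d⁄dX ℚ) h1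
    simp only [Derivation.leibniz, map_add, derivative_X, smul_eq_mul, Derivation.map_one_eq_zero,
      zero_add, mul_one] at h2
    have h3 : D * ((1 + X) * d⁄dX ℚ D + D) = 0 := by rw [h2, mul_zero]
    linear_combination h3 - h1 * d⁄dX ℚ D
  have h4 : (exp ℚ).subst (log ℚ) * D = 1 := by
    refine derivative.ext (R := ℚ) ?_ ?_
    · rw [Derivation.leibniz, hE, hD]
      simp only [smul_eq_mul, Derivation.map_one_eq_zero]
      ring
    · have hc : constantCoeff ((exp ℚ).subst (log ℚ)) = 1 := by
        have := constantCoeff_subst_eq_zero (a := log ℚ) constantCoeff_log (exp ℚ - 1) (by simp)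
        rw [subst_sub hasSubst_log, ← coe_substAlgHom hasSubst_log, map_one, map_sub] at this
        rw [← coe_substAlgHom hasSubst_log]
        change constantCoeff _ - constantCoeff 1 = 0 at this
        rw [map_one] at this
        exact sub_eq_zero.1 this
      have h5 := congrArg constantCoeff h1
      simp only [map_mul, map_add, map_one, constantCoeff_X, add_zero, one_mul] at h5
      rw [map_mul, hc, h5, map_one, mul_one]
  linear_combination (1 + X) * h4 - (exp ℚ).subst (log ℚ) * h1

/-- This is the residue of `dL / L^(m+1)` for `L = log (1 + w)`: for `m > 0` the form is exact, for
`m = 0` the pole is simple with residue 1. -/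
theorem coeff_derivative_log_mul_inv_pow (m : ℕ) :
    coeff m (d⁄dX ℚ (log ℚ) * logDivX⁻¹ ^ (m + 1)) = if m = 0 then 1 else 0 := by
  cases m with
  | zero =>
    simp [deriv_log, constantCoeff_logDivX, constantCoeff_mk]
  | succ r =>
    have hd : d⁄dX ℚ (log ℚ) = logDivX + X * d⁄dX ℚ logDivX := by
      rw [← X_mul_logDivX, Derivation.leibniz, derivative_X]
      simp only [smul_eq_mul]; ring
    have hN : X * d⁄dX ℚ (logDivX⁻¹ ^ (r + 1)) =
        -((r : ℚ⟦X⟧) + 1) * (X * d⁄dX ℚ logDivX * logDivX⁻¹ ^ (r + 2)) := by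
      rw [derivative_pow, derivative_inv', Nat.add_sub_cancel]
      push_cast
      ring
    have h1 : d⁄dX ℚ (log ℚ) * logDivX⁻¹ ^ (r + 1 + 1) =
        logDivX⁻¹ ^ (r + 1) + X * d⁄dX ℚ logDivX * logDivX⁻¹ ^ (r + 2) := by
      rw [hd]
      linear_combination logDivX⁻¹ ^ (r + 1) * logDivX_mul_inv
    have h2 := congrArg (coeff (r + 1)) hN
    rw [coeff_succ_X_mul, coeff_derivative,
      show -((r : ℚ⟦X⟧) + 1) = C (-((r : ℚ) + 1)) by simp, coeff_C_mul] at h2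
    have hr : (r : ℚ) + 1 ≠ 0 := by positivity
    rw [h1, map_add, if_neg (Nat.succ_ne_zero r)]
    apply mul_left_cancel₀ hr
    linear_combination h2

theorem subst_log_eq (f : ℚ⟦X⟧) : f.subst (log ℚ) =
    X * (logDivX * (mk fun i => coeff (i + 1) f).subst (log ℚ)) + C (constantCoeff f) := by
  conv_lhs => rw [eq_X_mul_shift_add_const f]
  rw [subst_add hasSubst_log, subst_mul hasSubst_log, subst_X hasSubst_log, subst_C,
    ← mul_assoc, X_mul_logDivX]
  rfl

/-- Lagrange's formula: change of variables `t = log (1 + w)` in a residue. -/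
theorem coeff_subst_log (m : ℕ) (f : ℚ⟦X⟧) :
    coeff m (f.subst (log ℚ) * (d⁄dX ℚ (log ℚ) * logDivX⁻¹ ^ (m + 1))) = coeff m f := by
  have h0 := coeff_derivative_log_mul_inv_pow m
  induction m generalizing f with
  | zero =>
    rw [subst_log_eq, add_mul, map_add, coeff_C_mul, h0, mul_assoc, coeff_zero_X_mul]
    simp
  | succ m ih =>
    have h1 := ih (mk fun i => coeff (i + 1) f) (coeff_derivative_log_mul_inv_pow m)
    rw [coeff_mk] at h1
    -- The constant of `f` contributes no residue; the rest carries a factor `log (1 + w)`, which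
    -- cancels one inverse power.
    rw [subst_log_eq, add_mul, map_add, coeff_C_mul, h0, if_neg (Nat.succ_ne_zero m), mul_zero,
      add_zero, mul_assoc, coeff_succ_X_mul, ← h1]
    congr 1
    linear_combination (mk fun i => coeff (i + 1) f).subst (log ℚ) * d⁄dX ℚ (log ℚ) *
      logDivX⁻¹ ^ (m + 1) * logDivX_mul_inv

theorem expSubOneDivT_subst_log : expSubOneDivT.subst (log ℚ) = logDivX⁻¹ := by
  have h1 : (1 : ℚ⟦X⟧).subst (log ℚ) = 1 := by
    rw [← coe_substAlgHom hasSubst_log, map_one]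
  have h2 := congrArg (fun f : ℚ⟦X⟧ => f.subst (log ℚ)) X_mul_expSubOneDivT
  simp only [subst_mul hasSubst_log, subst_X hasSubst_log, subst_sub hasSubst_log,
    exp_subst_log, h1] at h2
  generalize expSubOneDivT.subst (log ℚ) = g at h2 ⊢
  change log ℚ * g = 1 + X - 1 at h2
  rw [← X_mul_logDivX] at h2
  have h3 : logDivX * g = 1 := X_mul_cancel (by rw [← mul_assoc, h2]; ring)
  linear_combination logDivX⁻¹ * h3 - g * logDivX_mul_inv

theorem bernoulliGenPow_neg {k : ℕ} (hk : 0 < k) :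
    bernoulliGenPow (-(k : ℤ)) = expSubOneDivT ^ k := by
  obtain ⟨k, rfl⟩ := Nat.exists_eq_succ_of_ne_zero hk.ne'
  rfl

theorem eval_higherBernoulli {k : ℕ} (hk : 0 < k) (m : ℕ) (y : ℚ) :
    (higherBernoulli (-(k : ℤ)) m).eval y =
      m ! * coeff m (expSubOneDivT ^ k * rescale y (exp ℚ)) := by
  have h1 : (coeff m (map (Polynomial.C : ℚ →+* Polynomial ℚ) (expSubOneDivT ^ k) *
      rescale (Polynomial.X : Polynomial ℚ) (exp (Polynomial ℚ)))).eval y =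
      coeff m (map (Polynomial.evalRingHom y)
        (map (Polynomial.C : ℚ →+* Polynomial ℚ) (expSubOneDivT ^ k) *
      rescale (Polynomial.X : Polynomial ℚ) (exp (Polynomial ℚ)))) := by
    rw [coeff_map]; rfl
  rw [higherBernoulli, bernoulliGenPow_neg hk, Polynomial.eval_smul, smul_eq_mul, h1, map_mul]
  congr 3
  · rw [map_pow, map_pow]
    congr 1
    ext i; simp
  · ext i
    simp only [coeff_map, coeff_rescale, coeff_exp, map_mul, map_pow, Polynomial.coe_evalRingHom,
      Polynomial.eval_X]
    simp

/-- The shift by one absorbs `dt = dw / (1 + w)`: one factor of `(1 + w)^(r+1)` is lost. -/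
theorem eval_natCast_add_one_higherBernoulli {k : ℕ} (hk : 0 < k) (m r : ℕ) :
    (higherBernoulli (-(k : ℤ)) m).eval ((r : ℚ) + 1) =
      m ! * coeff m (logDivX⁻¹ ^ (m + k + 1) * (1 + X) ^ r) := by
  rw [eval_higherBernoulli hk, ← Nat.cast_add_one, ← exp_pow_eq_rescale_exp, ← coeff_subst_log,
    subst_mul hasSubst_log, subst_pow hasSubst_log, subst_pow hasSubst_log, exp_subst_log,
    expSubOneDivT_subst_log]
  congr 2
  linear_combination logDivX⁻¹ ^ (m + k + 1) * (1 + X) ^ r * one_add_X_mul_derivative_log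

/-- The coefficients of `B_m^{(-k)}(x + 1)` in the basis of falling factorials. -/
noncomputable def fallingCoeff (m n w : ℕ) : ℚ :=
  m ! / (m - w)! * coeff w (logDivX⁻¹ ^ (n + 1))

/-- It suffices to compare values at natural numbers `r`, where `(1 + w)^r` expands with binomial
coefficients. -/
theorem higherBernoulli_comp {k : ℕ} (hk : 0 < k) (m : ℕ) :
    (higherBernoulli (-(k : ℤ)) m).comp (Polynomial.X + 1) =
      ∑ w ∈ Finset.range (m + 1),
        Polynomial.C (fallingCoeff m (m + k) w) * descPochhammer ℚ (m - w) := by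
  refine Polynomial.eq_of_infinite_eval_eq _ _ (Set.Infinite.mono ?_
    (Set.infinite_range_of_injective (Nat.cast_injective (R := ℚ))))
  rintro _ ⟨r, rfl⟩
  simp only [Set.mem_ofPred_eq, Polynomial.eval_comp, Polynomial.eval_add, Polynomial.eval_X,
    Polynomial.eval_one, Polynomial.eval_finsetSum, Polynomial.eval_mul, Polynomial.eval_C]
  rw [eval_natCast_add_one_higherBernoulli hk, coeff_mul,
    Finset.Nat.sum_antidiagonal_eq_sum_range_succ_mk, Finset.mul_sum]
  refine Finset.sum_congr rfl fun w _ => ?_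
  have h1 : coeff (m - w) ((1 + X : ℚ⟦X⟧) ^ r) = r.choose (m - w) := by
    have : ((1 + Polynomial.X : Polynomial ℚ) ^ r : Polynomial ℚ) = ((1 + X : ℚ⟦X⟧) ^ r) := by
      simp
    rw [← this, Polynomial.coeff_coe, Polynomial.coeff_one_add_X_pow]
  have h2 : ((m - w)! : ℚ) ≠ 0 := by positivity
  rw [h1, fallingCoeff, descPochhammer_eval_eq_descFactorial,
    Nat.descFactorial_eq_factorial_mul_choose]
  push_cast
  field_simp

theorem higherBernoulli_eq {k : ℕ} (hk : 0 < k) (m : ℕ) :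
    higherBernoulli (-(k : ℤ)) m =
      ∑ w ∈ Finset.range (m + 1), Polynomial.C (fallingCoeff m (m + k) w) *
        ((descPochhammer ℤ (m - w)).comp (Polynomial.X - 1)).map (Int.castRingHom ℚ) := by
  have h := congrArg (fun f : Polynomial ℚ => f.comp (Polynomial.X - 1))
    (higherBernoulli_comp hk m)
  simp only [Polynomial.comp_assoc, Polynomial.add_comp, Polynomial.X_comp, Polynomial.one_comp,
    sub_add_cancel, Polynomial.comp_X] at h
  rw [h, ← Polynomial.coe_compRingHom_apply, map_sum]
  simp only [Polynomial.coe_compRingHom_apply, Polynomial.mul_comp, Polynomial.C_comp,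
    Polynomial.map_comp, Polynomial.map_sub, Polynomial.map_X, Polynomial.map_one,
    descPochhammer_map]

theorem descPochhammer_eval_neg_one (j : ℕ) :
    (descPochhammer ℚ j).eval (-1) = (-1) ^ j * j ! := by
  induction j with
  | zero => simp
  | succ j ih =>
    rw [descPochhammer_succ_eval, ih, Nat.factorial_succ]
    push_cast
    ring

theorem coeff_zero_higherBernoulli {k : ℕ} (hk : 0 < k) (m : ℕ) :
    (higherBernoulli (-(k : ℤ)) m).coeff 0 =
      ∑ w ∈ Finset.range (m + 1), fallingCoeff m (m + k) w * ((-1) ^ (m - w) * (m - w)!) := by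
  have h := congrArg (Polynomial.eval (-1)) (higherBernoulli_comp hk m)
  simp only [Polynomial.eval_comp, Polynomial.eval_add, Polynomial.eval_X,
    Polynomial.eval_one, Polynomial.eval_finsetSum, Polynomial.eval_mul, Polynomial.eval_C,
    neg_add_cancel, descPochhammer_eval_neg_one] at h
  rw [Polynomial.coeff_zero_eq_eval_zero, h]

theorem factorial_mul_coeff_exp_sub_one_pow (n k : ℕ) :
    n ! * coeff n ((exp ℚ - 1) ^ k) = (k ! * Nat.stirlingSecond n k : ℚ) := by
  induction n generalizing k with
  | zero => cases k <;> simp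
  | succ n ih =>
    cases k with
    | zero => simp [coeff_one]
    | succ k =>
      have h1 : d⁄dX ℚ ((exp ℚ - 1) ^ (k + 1)) =
          C ((k : ℚ) + 1) * ((exp ℚ - 1) ^ (k + 1) + (exp ℚ - 1) ^ k) := by
        rw [derivative_pow, map_sub, derivative_exp, Derivation.map_one_eq_zero]
        simp only [Nat.add_sub_cancel, map_add, map_one, map_natCast]
        push_cast
        ring
      have h2 := congrArg (coeff n) h1
      rw [coeff_derivative, coeff_C_mul, map_add] at h2
      rw [Nat.factorial_succ, Nat.stirlingSecond_succ_succ, Nat.factorial_succ]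
      have i1 := ih (k + 1)
      have i2 := ih k
      rw [Nat.factorial_succ] at i1
      push_cast at i1 ⊢
      linear_combination (n ! : ℚ) * h2 + ((k : ℚ) + 1) * (i1 + i2)

/-- Compare coefficients in `(e^t - 1)^k = t^k ((e^t - 1) / t)^k`. -/
theorem choose_mul_coeff_zero_higherBernoulli {k : ℕ} (hk : 0 < k) (m : ℕ) :
    ((m + k).choose k : ℚ) * (higherBernoulli (-(k : ℤ)) m).coeff 0 =
      Nat.stirlingSecond (m + k) k := by
  have h1 : (rescale (0 : ℚ)) (exp ℚ) = 1 := by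
    ext i; cases i <;> simp [coeff_one]
  have h2 := factorial_mul_coeff_exp_sub_one_pow (m + k) k
  rw [← X_mul_expSubOneDivT, mul_pow, add_comm m k, add_comm k m, coeff_X_pow_mul] at h2
  rw [Polynomial.coeff_zero_eq_eval_zero, eval_higherBernoulli hk, h1, mul_one]
  have h3 : ((m + k).choose k * k ! * m ! : ℚ) = (m + k)! := by
    have := Nat.choose_mul_factorial_mul_factorial (Nat.le_add_left k m)
    rw [Nat.add_sub_cancel] at this
    exact_mod_cast this
  have h4 : (k ! : ℚ) ≠ 0 := by positivity
  apply mul_left_cancel₀ h4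
  rw [← h2, ← h3]
  ring

end Series

/-! ### Multinomial expansion of the scalars. -/

/-- The contribution of the exponent vector `u` to the coefficient of `w ^ ∑ i * u i` in
`m! / (m - ∑ i * u i)! * (log (1 + w) / w) ^ (-(n + 1))`. -/
noncomputable def logMonomial (m n : ℕ) (u : ℕ → ℕ) : ℚ :=
  m ! / (m - ∑ i ∈ Finset.Icc 1 m, i * u i)! *
    ((n + ∑ i ∈ Finset.Icc 1 m, u i).choose n * (Nat.multinomial (Finset.Icc 1 m) u *
      ∏ i ∈ Finset.Icc 1 m, (-(-1) ^ i / ((i : ℚ) + 1)) ^ u i))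

open Classical in
/-- The exponent vectors supported in `[1, m]` of total degree at most `m`. -/
noncomputable def exponentVectors (m : ℕ) : Finset (ℕ → ℕ) :=
  (Finset.range (m + 1)).biUnion fun d => Finset.piAntidiag (Finset.Icc 1 m) d

section Expansion

open PowerSeries

/-- Modulo `X^(m+1)` the series is a polynomial, to which the multinomial theorem applies. -/
theorem coeff_one_sub_logDivX_pow {m w : ℕ} (hw : w ≤ m) (d : ℕ) :
    coeff w ((1 - logDivX) ^ d) =
      ∑ u ∈ Finset.piAntidiag (Finset.Icc 1 m) d,
        if ∑ i ∈ Finset.Icc 1 m, i * u i = w then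
          Nat.multinomial (Finset.Icc 1 m) u *
            ∏ i ∈ Finset.Icc 1 m, (-(-1) ^ i / ((i : ℚ) + 1)) ^ u i
        else 0 := by
  set t : ℚ⟦X⟧ := ∑ i ∈ Finset.Icc 1 m, C (-(-1) ^ i / ((i : ℚ) + 1)) * X ^ i with ht
  have h1 : X ^ (m + 1) ∣ (1 - logDivX) - t := by
    rw [X_pow_dvd_iff]
    intro j hj
    rw [ht, map_sub, map_sub, map_sum]
    simp only [coeff_C_mul_X_pow]
    rw [Finset.sum_ite_eq]
    rcases Nat.eq_zero_or_pos j with rfl | hj0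
    · simp [logDivX]
    · rw [if_pos (Finset.mem_Icc.2 ⟨hj0, by omega⟩), coeff_one, if_neg hj0.ne']
      simp only [logDivX, coeff_mk]
      ring
  have h2 : X ^ (m + 1) ∣ (1 - logDivX) ^ d - t ^ d := h1.trans (sub_dvd_pow_sub_pow _ _ d)
  have h3 := X_pow_dvd_iff.1 h2 w (by omega)
  rw [map_sub, sub_eq_zero] at h3
  rw [h3, ht, Finset.sum_pow_eq_sum_piAntidiag, map_sum]
  refine Finset.sum_congr rfl fun u _ => ?_
  have h4 : ∏ i ∈ Finset.Icc 1 m, (C (-(-1) ^ i / ((i : ℚ) + 1)) * (X : ℚ⟦X⟧) ^ i) ^ u i =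
      C (∏ i ∈ Finset.Icc 1 m, (-(-1) ^ i / ((i : ℚ) + 1)) ^ u i) *
        (X : ℚ⟦X⟧) ^ (∑ i ∈ Finset.Icc 1 m, i * u i) := by
    rw [map_prod, ← Finset.prod_pow_eq_pow_sum, ← Finset.prod_mul_distrib]
    refine Finset.prod_congr rfl fun i _ => ?_
    rw [mul_pow, map_pow, ← pow_mul]
  rw [h4, ← map_natCast (C (R := ℚ)), ← mul_assoc, ← map_mul, coeff_C_mul_X_pow]
  simp only [eq_comm]

/-- Negative binomial series in `1 - logDivX`, which has no constant term; hence `d ≤ m` suffices.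
-/
theorem coeff_inv_logDivX_pow (n w : ℕ) {m : ℕ} (hw : w ≤ m) :
    coeff w (logDivX⁻¹ ^ (n + 1)) =
      ∑ d ∈ Finset.range (m + 1), ((n + d).choose n : ℚ) * coeff w ((1 - logDivX) ^ d) := by
  have hE : constantCoeff (1 - logDivX) = 0 := by
    rw [map_sub, map_one, constantCoeff_logDivX, sub_self]
  have hs : HasSubst (1 - logDivX) := HasSubst.of_constantCoeff_zero' hE
  have h1 := congrArg (fun f : ℚ⟦X⟧ => f.subst (1 - logDivX))
    (mk_add_choose_mul_one_sub_pow_eq_one ℚ n)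
  have hone : (1 : ℚ⟦X⟧).subst (1 - logDivX) = 1 := by
    rw [← coe_substAlgHom hs, map_one]
  simp only [subst_mul hs, subst_pow hs, subst_sub hs, hone, subst_X hs, sub_sub_cancel] at h1
  generalize hg : (mk fun i => ((n + i).choose n : ℚ)).subst (1 - logDivX) = g at h1
  change g * logDivX ^ (n + 1) = 1 at h1
  have h2 : logDivX⁻¹ ^ (n + 1) = g := by
    have h3 : logDivX ^ (n + 1) * logDivX⁻¹ ^ (n + 1) = 1 := by
      rw [← mul_pow, logDivX_mul_inv, one_pow]
    linear_combination g * h3 - logDivX⁻¹ ^ (n + 1) * h1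
  rw [h2, ← hg, coeff_subst' hs, finsum_eq_sum_of_support_subset (s := Finset.range (m + 1))]
  · simp only [coeff_mk, smul_eq_mul]
  · intro d hd
    rw [Finset.coe_range, Set.mem_Iio]
    by_contra! hlt
    refine hd ?_
    have h4 : X ^ d ∣ (1 - logDivX) ^ d := pow_dvd_pow_of_dvd (X_dvd_iff.2 hE) d
    simp only [X_pow_dvd_iff.1 h4 w (by omega), smul_zero]

theorem sum_exponentVectors {m : ℕ} (f : (ℕ → ℕ) → ℚ) :
    ∑ u ∈ exponentVectors m, f u =
      ∑ d ∈ Finset.range (m + 1), ∑ u ∈ Finset.piAntidiag (Finset.Icc 1 m) d, f u := by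
  classical
  rw [exponentVectors, Finset.sum_biUnion]
  intro d _ e _ hde
  rw [Function.onFun, Finset.disjoint_left]
  intro u hu hu'
  rw [Finset.mem_piAntidiag] at hu hu'
  exact hde (hu.1.symm.trans hu'.1)

theorem fallingCoeff_eq_sum {m n w : ℕ} (hw : w ≤ m) :
    fallingCoeff m n w =
      ∑ u ∈ exponentVectors m with ∑ i ∈ Finset.Icc 1 m, i * u i = w, logMonomial m n u := by
  rw [Finset.sum_filter, sum_exponentVectors, fallingCoeff, coeff_inv_logDivX_pow n w hw,
    Finset.mul_sum]
  refine Finset.sum_congr rfl fun d _ => ?_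
  rw [coeff_one_sub_logDivX_pow hw, Finset.mul_sum, Finset.mul_sum]
  refine Finset.sum_congr rfl fun u hu => ?_
  split_ifs with h
  · rw [logMonomial, h, (Finset.mem_piAntidiag.1 hu).1]
  · simp

end Expansion

/-! ### Valuations of the monomials. -/

section Valuation

variable {p : ℕ} [hp : Fact p.Prime]

theorem padicValRat_prod {ι : Type*} (s : Finset ι) (f : ι → ℚ) (hf : ∀ i ∈ s, f i ≠ 0) :
    padicValRat p (∏ i ∈ s, f i) = ∑ i ∈ s, padicValRat p (f i) := by
  classical
  induction s using Finset.induction_on with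
  | empty => simp
  | insert a s ha ih =>
    rw [Finset.prod_insert ha, Finset.sum_insert ha, padicValRat.mul
      (hf a (Finset.mem_insert_self a s))
      (Finset.prod_ne_zero_iff.2 fun i hi => hf i (Finset.mem_insert_of_mem hi)),
      ih fun i hi => hf i (Finset.mem_insert_of_mem hi)]

theorem sub_one_mul_padicValRat_factorial (x : ℕ) :
    ((p : ℤ) - 1) * padicValRat p (x ! : ℚ) = x - digitSum p x := by
  have h := sub_one_mul_padicValNat_factorial_add_digitSum (p := p) x
  zify [hp.out.one_lt.le] at h
  linarith

theorem sub_one_mul_padicValRat_choose (n d : ℕ) :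
    ((p : ℤ) - 1) * padicValRat p ((n + d).choose n : ℚ) =
      digitSum p n + digitSum p d - digitSum p (n + d) := by
  have h := digitSum_add_digitSum (p := p) n d
  zify [hp.out.one_lt.le] at h
  linarith

theorem sub_one_mul_padicValRat_multinomial (s : Finset ℕ) (u : ℕ → ℕ) :
    ((p : ℤ) - 1) * padicValRat p (Nat.multinomial s u : ℚ) =
      ∑ i ∈ s, (digitSum p (u i) : ℤ) - digitSum p (∑ i ∈ s, u i) := by
  have h : (∏ i ∈ s, ((u i)! : ℚ)) * (Nat.multinomial s u : ℚ) = ((∑ i ∈ s, u i)! : ℕ) := by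
    rw [← Nat.multinomial_spec]; push_cast; rfl
  have h1 := congrArg (fun x => ((p : ℤ) - 1) * padicValRat p x) h
  have hne : (Nat.multinomial s u : ℚ) ≠ 0 := by
    exact_mod_cast (Nat.multinomial_pos s u).ne'
  rw [padicValRat.mul (Finset.prod_ne_zero_iff.2 fun i _ => by positivity) hne, mul_add,
    padicValRat_prod _ _ (fun i _ => by positivity), Finset.mul_sum,
    sub_one_mul_padicValRat_factorial] at h1
  simp only [sub_one_mul_padicValRat_factorial, Finset.sum_sub_distrib] at h1
  push_cast at h1
  linarith

theorem logMonomial_ne_zero (m n : ℕ) (u : ℕ → ℕ) : logMonomial m n u ≠ 0 := by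
  refine mul_ne_zero (by positivity) (mul_ne_zero ?_ (mul_ne_zero ?_ ?_))
  · exact_mod_cast (Nat.choose_pos (Nat.le_add_right _ _)).ne'
  · exact_mod_cast (Nat.multinomial_pos _ _).ne'
  · refine Finset.prod_ne_zero_iff.2 fun i _ => pow_ne_zero _ (div_ne_zero ?_ (by positivity))
    exact neg_ne_zero.2 (pow_ne_zero _ (by norm_num))

theorem padicValRat_neg_one_pow_div (i : ℕ) :
    padicValRat p (-(-1) ^ i / ((i : ℚ) + 1)) = -padicValRat p ((i : ℚ) + 1) := by
  rw [padicValRat.div (neg_ne_zero.2 (pow_ne_zero _ (by norm_num))) (by positivity),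
    padicValRat.neg, padicValRat.pow, padicValRat.neg, padicValRat.one]
  ring

/-- Each `1 / (i + 1)` contributes `logSlack p i - i`. The total weight `m - Z` so subtracted
cancels the main term of `m! / Z!` in Legendre's formula. -/
theorem sub_one_mul_padicValRat_logMonomial {m : ℕ} (n : ℕ) (u : ℕ → ℕ) {Z : ℕ}
    (hZ : ∑ i ∈ Finset.Icc 1 m, i * u i + Z = m) :
    ((p : ℤ) - 1) * padicValRat p (logMonomial m n u) =
      digitSum p n + ∑ i ∈ Finset.Icc 1 m, (digitSum p (u i) : ℤ) +
        ∑ i ∈ Finset.Icc 1 m, (logSlack p i * u i : ℤ) + digitSum p Z -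
        digitSum p (n + ∑ i ∈ Finset.Icc 1 m, u i) - digitSum p m := by
  have hZ' : m - ∑ i ∈ Finset.Icc 1 m, i * u i = Z := by omega
  have h0 : ∀ i : ℕ, -(-1) ^ i / ((i : ℚ) + 1) ≠ 0 := fun i =>
    div_ne_zero (neg_ne_zero.2 (pow_ne_zero _ (by norm_num))) (by positivity)
  have hne := logMonomial_ne_zero m n u
  rw [logMonomial] at hne ⊢
  rw [hZ'] at hne ⊢
  have hne1 := right_ne_zero_of_mul hne
  have hne2 := right_ne_zero_of_mul hne1
  rw [padicValRat.mul (left_ne_zero_of_mul hne) hne1,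
    padicValRat.mul (left_ne_zero_of_mul hne1) hne2,
    padicValRat.mul (left_ne_zero_of_mul hne2) (right_ne_zero_of_mul hne2),
    padicValRat.div (by positivity) (by positivity),
    padicValRat_prod _ _ (fun i _ => pow_ne_zero _ (h0 i)), mul_add, mul_add, mul_add, mul_sub,
    sub_one_mul_padicValRat_factorial, sub_one_mul_padicValRat_factorial,
    sub_one_mul_padicValRat_choose, sub_one_mul_padicValRat_multinomial, Finset.mul_sum]
  have h1 : ∑ i ∈ Finset.Icc 1 m, ((p : ℤ) - 1) *
      padicValRat p ((-(-1) ^ i / ((i : ℚ) + 1)) ^ u i) =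
      ∑ i ∈ Finset.Icc 1 m, (logSlack p i * u i : ℤ) - ((m : ℤ) - Z) := by
    have h2 : (m : ℤ) - Z = ∑ i ∈ Finset.Icc 1 m, (i * u i : ℤ) := by
      rw [eq_comm, eq_sub_iff_add_eq]
      exact_mod_cast hZ
    rw [h2, ← Finset.sum_sub_distrib]
    refine Finset.sum_congr rfl fun i _ => ?_
    rw [padicValRat.pow, padicValRat_neg_one_pow_div]
    have h3 := logSlack_add (p := p) i
    zify [hp.out.one_lt.le] at h3
    linear_combination (-(u i : ℤ)) * h3
  rw [h1]
  ring

end Valuation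

/-! ### Splitting `n` at the bottom segment. -/

/-- A bottom segment `r + c * p ^ b` of `n = r + p ^ b * (c + q)`, with `c ≤ p - 2`, together with
`k` and `u` such that `k + (p - 1) * u` is that segment and adding `u` to `n` in base `p` produces
no carry. -/
structure IsSplitting (p b c r q u k : ℕ) : Prop where
  c_le : c + 2 ≤ p
  r_lt : r < p ^ b
  k_pos : 0 < k
  k_add : k + (p - 1) * u = r + p ^ b * c
  digitSum_low : digitSum p (r + u) = digitSum p r + digitSum p u
  digitSum_high : digitSum p (c + q) = c + digitSum p q

section Splitting

variable {p : ℕ} [hp : Fact p.Prime]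

theorem IsBottomSegment.exists_split {n B : ℕ} (hB : IsBottomSegment p n B) :
    ∃ b c r q, c + 2 ≤ p ∧ r < p ^ b ∧ B = r + p ^ b * c ∧ n = r + p ^ b * (c + q) ∧
      digitSum p (c + q) = c + digitSum p q := by
  obtain ⟨b, c, hc, rfl⟩ := hB
  have hp2 := hp.out.two_le
  have hlt : n / p ^ b % p < p := Nat.mod_lt _ hp.out.pos
  by_cases h : c + 2 ≤ p
  · have hN := Nat.mod_add_div (n / p ^ b) p
    refine ⟨b, c, n % p ^ b, n / p ^ b - c, h, Nat.mod_lt _ (pow_pos hp.out.pos b),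
      by ring, ?_, ?_⟩
    · rw [Nat.add_sub_cancel' (by omega), Nat.mod_add_div]
    · have h1 : n / p ^ b - c = (n / p ^ b % p - c) + p * (n / p ^ b / p) := by omega
      rw [Nat.add_sub_cancel' (by omega), h1, digitSum_add_mul (by omega),
        digitSum_eq_mod_add_div (n / p ^ b)]
      omega
  -- Here `c = p - 1` is the whole digit, so the segment ends at `b + 1` with leading part 0.
  · refine ⟨b + 1, 0, n % p ^ (b + 1), n / p ^ (b + 1), by omega,
      Nat.mod_lt _ (pow_pos hp.out.pos _), ?_, ?_, by simp⟩
    · rw [Nat.mod_pow_succ, mul_zero, add_zero, show c = n / p ^ b % p by omega, mul_comm]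
    · rw [zero_add, Nat.mod_add_div]

namespace IsSplitting

variable {b c r q u k : ℕ}

omit hp in
theorem mul_lt (h : IsSplitting p b c r q u k) : (p - 1) * u < p ^ b * (c + 1) := by
  have h1 := h.k_add
  have h2 := h.k_pos
  have h3 := h.r_lt
  rw [mul_add]
  omega

omit hp in
theorem u_lt (h : IsSplitting p b c r q u k) : u < p ^ b := by
  have h1 := h.c_le
  by_contra! hle
  have h2 : (p - 1) * p ^ b ≤ (p - 1) * u := Nat.mul_le_mul_left _ hle
  have h3 : p ^ b * (c + 1) ≤ p ^ b * (p - 1) := Nat.mul_le_mul_left _ (by omega)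
  have h4 := h.mul_lt
  rw [mul_comm] at h2
  omega

theorem digitSum_n (h : IsSplitting p b c r q u k) :
    digitSum p (r + p ^ b * (c + q)) = digitSum p r + c + digitSum p q := by
  rw [digitSum_add_pow_mul h.r_lt, h.digitSum_high, add_assoc]

theorem digitSum_B (h : IsSplitting p b c r q u k) :
    digitSum p (r + p ^ b * c) = digitSum p r + c := by
  rw [digitSum_add_pow_mul h.r_lt, digitSum_of_lt (x := c) (by have := h.c_le; omega)]

/-- The high part of `x` is at most `c`, and `c + q` has no carry, so a smaller summand has none
either. -/
theorem digitSum_add_high (h : IsSplitting p b c r q u k) {x : ℕ} (hx : x < p ^ b * (c + 1)) :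
    digitSum p (x + p ^ b * q) = digitSum p x + digitSum p q := by
  have ht : x / p ^ b < c + 1 := Nat.div_lt_of_lt_mul hx
  have hlt := Nat.mod_lt x (pow_pos hp.out.pos b)
  have h1 := digitSum_eq_mod_add_div_pow (p := p) x b
  have h2 : digitSum p (x + p ^ b * q) =
      digitSum p (x % p ^ b) + digitSum p (x / p ^ b + q) := by
    rw [← digitSum_add_pow_mul hlt]
    conv_lhs => rw [← Nat.mod_add_div x (p ^ b)]
    ring_nf
  have h3 := digitSum_add_le (p := p) (c - x / p ^ b) (x / p ^ b + q)
  rw [← add_assoc, Nat.sub_add_cancel (by omega), h.digitSum_high] at h3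
  have h4 := digitSum_le_self (p := p) (c - x / p ^ b)
  have h5 := digitSum_le_self (p := p) (x / p ^ b)
  have h6 := digitSum_add_le (p := p) (x / p ^ b) q
  omega

theorem digitSum_m (h : IsSplitting p b c r q u k) :
    digitSum p ((p - 1) * u + p ^ b * q) = digitSum p ((p - 1) * u) + digitSum p q :=
  h.digitSum_add_high h.mul_lt

theorem digitSum_n_add_u (h : IsSplitting p b c r q u k) :
    digitSum p (r + p ^ b * (c + q) + u) = digitSum p r + c + digitSum p u + digitSum p q := by
  have h1 := add_lt_of_digitSum_add_eq h.r_lt h.u_lt h.digitSum_low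
  rw [add_right_comm, digitSum_add_pow_mul h1, h.digitSum_low, h.digitSum_high]
  ring

end IsSplitting

/-- The order of the maximal pole. -/
def poleOrder (p u : ℕ) : ℕ := digitSum p ((p - 1) * u) / (p - 1)

theorem sub_one_mul_poleOrder (u : ℕ) :
    (p - 1) * poleOrder p u = digitSum p ((p - 1) * u) := by
  refine Nat.mul_div_cancel' ?_
  have h := digitSum_modEq (p := p) ((p - 1) * u)
  exact (Nat.modEq_zero_iff_dvd).1 (h.trans (Nat.modEq_zero_iff_dvd.2 (Dvd.intro _ rfl)))

end Splitting

/-! ### Poles in terms of the `p`-adic norm. -/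

section Norm

variable {p : ℕ} [hp : Fact p.Prime] {x : ℚ} {M : ℕ}

theorem padicNorm_le_pow_iff (hx : x ≠ 0) :
    padicNorm p x ≤ (p : ℚ) ^ M ↔ 0 ≤ padicValRat p x + M := by
  have hp1 : (1 : ℚ) < p := by exact_mod_cast hp.out.one_lt
  rw [padicNorm.eq_zpow_of_nonzero hx, ← zpow_natCast, zpow_le_zpow_iff_right₀ hp1]
  constructor <;> intro h <;> linarith

theorem padicNorm_lt_pow_iff (hx : x ≠ 0) :
    padicNorm p x < (p : ℚ) ^ M ↔ 0 < padicValRat p x + M := by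
  have hp1 : (1 : ℚ) < p := by exact_mod_cast hp.out.one_lt
  rw [padicNorm.eq_zpow_of_nonzero hx, ← zpow_natCast, zpow_lt_zpow_iff_right₀ hp1]
  constructor <;> intro h <;> linarith

theorem hasPoleOfOrder_iff : HasPoleOfOrder p x M ↔ padicNorm p x = (p : ℚ) ^ M := by
  have hp0 : (0 : ℚ) < p := by exact_mod_cast hp.out.pos
  have hp1 : (p : ℚ) ≠ 1 := by exact_mod_cast hp.out.one_lt.ne'
  constructor
  · rintro ⟨hx, hv⟩
    rw [padicNorm.eq_zpow_of_nonzero hx, hv, neg_neg, zpow_natCast]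
  · intro h
    have hx : x ≠ 0 := by
      rintro rfl
      rw [padicNorm.zero] at h
      exact (pow_pos hp0 M).ne h
    refine ⟨hx, ?_⟩
    rw [padicNorm.eq_zpow_of_nonzero hx, ← zpow_natCast] at h
    have := zpow_right_injective₀ hp0 hp1 h
    omega

theorem padicValNat_den_le (h : padicNorm p x ≤ (p : ℚ) ^ M) : padicValNat p x.den ≤ M := by
  rcases Nat.eq_zero_or_pos (padicValNat p x.den) with h0 | h0
  · omega
  have hx : x ≠ 0 := by rintro rfl; simp at h0
  rw [padicNorm_le_pow_iff hx] at h
  have hden : p ∣ x.den := dvd_of_one_le_padicValNat h0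
  have hnum : ¬ (p : ℤ) ∣ x.num := by
    intro hd
    have h1 := Nat.dvd_gcd (Int.natCast_dvd.1 hd) hden
    rw [x.reduced.gcd_eq_one] at h1
    exact hp.out.one_lt.ne' (Nat.dvd_one.1 h1)
  rw [padicValRat_def, padicValInt.eq_zero_of_not_dvd hnum] at h
  rw [Nat.cast_zero, zero_sub] at h
  omega

omit hp in
theorem HasPoleOfOrder.le_padicValNat_den (h : HasPoleOfOrder p x M) :
    M ≤ padicValNat p x.den := by
  have h1 := h.2
  rw [padicValRat_def] at h1
  omega

theorem maxPole_eq {f : Polynomial ℚ} {d : ℕ} (hle : ∀ i, padicNorm p (f.coeff i) ≤ (p : ℚ) ^ M)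
    (hd : HasPoleOfOrder p (f.coeff d) M) : maxPole p f = M := by
  refine le_antisymm (Finset.sup_le fun i _ => padicValNat_den_le (hle i)) ?_
  refine hd.le_padicValNat_den.trans ?_
  exact Finset.le_sup (f := fun i => padicValNat p (f.coeff i).den)
    (Polynomial.mem_support_iff.2 hd.1)

/-- One dominant term determines the norm of a sum. -/
theorem padicNorm_sum_eq {ι : Type*} {s : Finset ι} {f : ι → ℚ} {t : ℚ} {a : ι} (ha : a ∈ s)
    (ht : 0 < t) (hfa : padicNorm p (f a) = t) (hlt : ∀ i ∈ s, i ≠ a → padicNorm p (f i) < t) :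
    padicNorm p (∑ i ∈ s, f i) = t := by
  classical
  rw [← Finset.add_sum_erase s f ha]
  have h1 : padicNorm p (∑ i ∈ s.erase a, f i) < t :=
    padicNorm.sum_lt' (fun i hi => hlt i (Finset.mem_of_mem_erase hi) (Finset.ne_of_mem_erase hi))
      ht
  rw [padicNorm.add_eq_max_of_ne (by rw [hfa]; exact h1.ne'), hfa, max_eq_left h1.le]

end Norm

/-! ### Exponent vectors concentrated at `p - 1`. -/

section PureVector

variable {p : ℕ} [hp : Fact p.Prime] {m D : ℕ}

omit hp in
theorem mem_exponentVectors {a : ℕ → ℕ} :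
    a ∈ exponentVectors m ↔ ∃ d ≤ m, a ∈ Finset.piAntidiag (Finset.Icc 1 m) d := by
  classical
  rw [exponentVectors, Finset.mem_biUnion]
  simp only [Finset.mem_range, Nat.lt_succ_iff]

theorem sum_single_sub_one (hD : (p - 1) * D ≤ m) (g : ℕ → ℕ → ℕ) (hg : ∀ i, g i 0 = 0) :
    ∑ i ∈ Finset.Icc 1 m, g i ((Pi.single (p - 1) D : ℕ → ℕ) i) = g (p - 1) D := by
  have hp1 := hp.out.one_lt
  rcases Nat.eq_zero_or_pos D with rfl | hD0
  · simp [hg]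
  · have h1 : p - 1 ≤ (p - 1) * D := Nat.le_mul_of_pos_right _ hD0
    rw [Finset.sum_eq_single_of_mem (p - 1) (Finset.mem_Icc.2 ⟨by omega, by omega⟩)]
    · rw [Pi.single_eq_same]
    · intro i _ hi
      rw [Pi.single_eq_of_ne hi, hg]

theorem single_mem_exponentVectors (hD : (p - 1) * D ≤ m) :
    Pi.single (p - 1) D ∈ exponentVectors m := by
  have hp1 := hp.out.one_lt
  have h1 : D ≤ (p - 1) * D := Nat.le_mul_of_pos_left _ (by omega)
  rw [mem_exponentVectors]
  refine ⟨D, by omega, Finset.mem_piAntidiag.2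
    ⟨sum_single_sub_one hD (fun _ x => x) fun _ => rfl, fun i hi => ?_⟩⟩
  obtain rfl : i = p - 1 := by
    by_contra hne
    exact hi (Pi.single_eq_of_ne hne _)
  rw [Pi.single_eq_same] at hi
  have : p - 1 ≤ (p - 1) * D := Nat.le_mul_of_pos_right _ (Nat.pos_of_ne_zero hi)
  exact Finset.mem_Icc.2 ⟨by omega, by omega⟩

theorem eq_single_of_pure {a : ℕ → ℕ} (ha : a ∈ exponentVectors m)
    (hpure : ∀ i ∈ Finset.Icc 1 m, i ≠ p - 1 → a i = 0)
    (hw : ∑ i ∈ Finset.Icc 1 m, i * a i = (p - 1) * D) : a = Pi.single (p - 1) D := by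
  have hp1 := hp.out.one_lt
  rw [mem_exponentVectors] at ha
  obtain ⟨d, -, hd⟩ := ha
  rw [Finset.mem_piAntidiag] at hd
  have h0 : ∀ i, i ≠ p - 1 → a i = 0 := by
    intro i hi
    by_contra hne
    exact hne (hpure i (hd.2 i hne) hi)
  have h1 : a = Pi.single (p - 1) (a (p - 1)) := by
    funext i
    by_cases hi : i = p - 1
    · rw [hi, Pi.single_eq_same]
    · rw [Pi.single_eq_of_ne hi, h0 i hi]
  have h2 : ∑ i ∈ Finset.Icc 1 m, i * a i = (p - 1) * a (p - 1) := by
    by_cases hm : p - 1 ∈ Finset.Icc 1 m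
    · exact Finset.sum_eq_single_of_mem _ hm fun i _ hi => by rw [h0 i hi, mul_zero]
    · have h3 : a (p - 1) = 0 := by
        by_contra hne
        exact hm (hd.2 _ hne)
      rw [h3, mul_zero]
      refine Finset.sum_eq_zero fun i hi => ?_
      rw [h0 i (by rintro rfl; exact hm hi), mul_zero]
  rw [h1, Nat.eq_of_mul_eq_mul_left (by omega) (h2.symm.trans hw)]

end PureVector

/-! ### Poles of the scalars and of the polynomial coefficients. -/

section PoleOrder

variable {p : ℕ} [hp : Fact p.Prime] {b c r q u k m n : ℕ}

namespace IsSplitting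

theorem sub_one_mul_padicValRat_logMonomial_add (h : IsSplitting p b c r q u k)
    (hm : m = (p - 1) * u + p ^ b * q) (hn : n = r + p ^ b * (c + q)) {a : ℕ → ℕ} {Z : ℕ}
    (hZ : ∑ i ∈ Finset.Icc 1 m, i * a i + Z = m) :
    ((p : ℤ) - 1) * (padicValRat p (logMonomial m n a) + poleOrder p u) =
      ((digitSum p r + c + ∑ i ∈ Finset.Icc 1 m, digitSum p (a i) +
        ∑ i ∈ Finset.Icc 1 m, logSlack p i * a i + digitSum p Z : ℕ) : ℤ) -
        (digitSum p (n + ∑ i ∈ Finset.Icc 1 m, a i) : ℕ) := by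
  have h1 := sub_one_mul_padicValRat_logMonomial (p := p) n a hZ
  have h2 : ((p : ℤ) - 1) * poleOrder p u = digitSum p ((p - 1) * u) := by
    rw [← sub_one_mul_poleOrder u]
    push_cast [hp.out.one_lt.le]
    ring
  have h3 : (digitSum p n : ℤ) = digitSum p r + c + digitSum p q := by
    rw [hn]; exact_mod_cast h.digitSum_n
  have h4 : (digitSum p m : ℤ) = digitSum p ((p - 1) * u) + digitSum p q := by
    rw [hm]; exact_mod_cast h.digitSum_m
  rw [mul_add, h1, h2, h3, h4]
  push_cast
  ring

theorem padicNorm_logMonomial_le (h : IsSplitting p b c r q u k)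
    (hm : m = (p - 1) * u + p ^ b * q) (hn : n = r + p ^ b * (c + q)) {a : ℕ → ℕ}
    (ha : ∑ i ∈ Finset.Icc 1 m, i * a i ≤ m) :
    padicNorm p (logMonomial m n a) ≤ (p : ℚ) ^ poleOrder p u := by
  have hZ := Nat.add_sub_cancel' ha
  have h1 := h.sub_one_mul_padicValRat_logMonomial_add hm hn hZ
  have h2 := digitSum_add_sum_le h.c_le r h.mul_lt (hZ.trans hm)
  rw [← hn] at h2
  have hp1 : (0 : ℤ) < p - 1 := by have := hp.out.one_lt; omega
  rw [padicNorm_le_pow_iff (logMonomial_ne_zero _ _ _)]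
  refine nonneg_of_mul_nonneg_right ?_ hp1
  rw [h1]
  omega

theorem padicNorm_logMonomial_lt (h : IsSplitting p b c r q u k)
    (hm : m = (p - 1) * u + p ^ b * q) (hn : n = r + p ^ b * (c + q)) {a : ℕ → ℕ} {Z : ℕ}
    (hZ : ∑ i ∈ Finset.Icc 1 m, i * a i + Z = m)
    (hlt : digitSum p (n + ∑ i ∈ Finset.Icc 1 m, a i) <
      digitSum p r + c + ∑ i ∈ Finset.Icc 1 m, digitSum p (a i) +
        ∑ i ∈ Finset.Icc 1 m, logSlack p i * a i + digitSum p Z) :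
    padicNorm p (logMonomial m n a) < (p : ℚ) ^ poleOrder p u := by
  have h1 := h.sub_one_mul_padicValRat_logMonomial_add hm hn hZ
  have hp1 : (0 : ℤ) < p - 1 := by have := hp.out.one_lt; omega
  rw [padicNorm_lt_pow_iff (logMonomial_ne_zero _ _ _)]
  refine pos_of_mul_pos_right ?_ hp1.le
  rw [h1]
  omega

theorem padicNorm_logMonomial_single (h : IsSplitting p b c r q u k)
    (hm : m = (p - 1) * u + p ^ b * q) (hn : n = r + p ^ b * (c + q)) {D Z : ℕ}
    (hZ : (p - 1) * D + Z = m)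
    (heq : digitSum p (n + D) = digitSum p r + c + digitSum p D + digitSum p Z) :
    padicNorm p (logMonomial m n (Pi.single (p - 1) D)) = (p : ℚ) ^ poleOrder p u := by
  have hD : (p - 1) * D ≤ m := by omega
  have s1 := sum_single_sub_one hD (fun _ x => x) fun _ => rfl
  have s2 := sum_single_sub_one hD (fun i x => i * x) fun _ => rfl
  have s3 := sum_single_sub_one hD (fun _ x => digitSum p x) fun _ => digitSum_zero
  have s4 := sum_single_sub_one hD (fun i x => logSlack p i * x) fun _ => rfl
  simp only [logSlack_sub_one, zero_mul] at s1 s2 s3 s4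
  have h1 := h.sub_one_mul_padicValRat_logMonomial_add hm hn
    (a := Pi.single (p - 1) D) (Z := Z) (by rw [s2, hZ])
  rw [s1, s3, s4, heq, add_zero, sub_self] at h1
  have hp1 : (p : ℤ) - 1 ≠ 0 := by have := hp.out.one_lt; omega
  have h2 := (mul_eq_zero.1 h1).resolve_left hp1
  exact hasPoleOfOrder_iff.1 ⟨logMonomial_ne_zero _ _ _, by omega⟩

theorem padicNorm_fallingCoeff_le (h : IsSplitting p b c r q u k)
    (hm : m = (p - 1) * u + p ^ b * q) (hn : n = r + p ^ b * (c + q)) {w : ℕ} (hw : w ≤ m) :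
    padicNorm p (fallingCoeff m n w) ≤ (p : ℚ) ^ poleOrder p u := by
  rw [fallingCoeff_eq_sum hw]
  refine padicNorm.sum_le' (fun a ha => ?_) (by positivity)
  rw [Finset.mem_filter] at ha
  exact h.padicNorm_logMonomial_le hm hn (ha.2.trans_le hw)

/-- Subadditivity is enough up to weight `(p-1) u`; `x` is the weight missing from it, and its digit
sum is the gain. -/
theorem digitSum_add_sum_le_of_weight_le (h : IsSplitting p b c r q u k)
    (hn : n = r + p ^ b * (c + q)) {s : Finset ℕ} {a : ℕ → ℕ} {x : ℕ}
    (hx : x ≤ (p - 1) * u) :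
    digitSum p (n + ∑ i ∈ s, a i) + digitSum p x ≤
      digitSum p r + c + ∑ i ∈ s, digitSum p (a i) + digitSum p (x + p ^ b * q) := by
  have h1 := digitSum_add_le (p := p) n (∑ i ∈ s, a i)
  have h2 := digitSum_sum_le (p := p) s a
  have h3 := h.digitSum_n
  have h4 := h.digitSum_add_high (hx.trans_lt h.mul_lt)
  rw [← hn] at h3
  omega

theorem padicNorm_fallingCoeff_lt (h : IsSplitting p b c r q u k)
    (hm : m = (p - 1) * u + p ^ b * q) (hn : n = r + p ^ b * (c + q)) {w : ℕ}
    (hw : w < (p - 1) * u) :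
    padicNorm p (fallingCoeff m n w) < (p : ℚ) ^ poleOrder p u := by
  have hp0 : (0 : ℚ) < p := by exact_mod_cast hp.out.pos
  rw [fallingCoeff_eq_sum (by omega)]
  refine padicNorm.sum_lt' (fun a ha => ?_) (by positivity)
  rw [Finset.mem_filter] at ha
  refine h.padicNorm_logMonomial_lt hm hn (Z := (p - 1) * u - w + p ^ b * q)
    (by rw [ha.2]; omega) ?_
  have h1 := h.digitSum_add_sum_le_of_weight_le hn (s := Finset.Icc 1 m) (a := a)
    (x := (p - 1) * u - w) (by omega)
  have h2 := digitSum_pos (p := p) (x := (p - 1) * u - w) (by omega)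
  omega

theorem padicNorm_fallingCoeff_eq (h : IsSplitting p b c r q u k)
    (hm : m = (p - 1) * u + p ^ b * q) (hn : n = r + p ^ b * (c + q)) :
    padicNorm p (fallingCoeff m n ((p - 1) * u)) = (p : ℚ) ^ poleOrder p u := by
  have hp0 : (0 : ℚ) < p := by exact_mod_cast hp.out.pos
  have hle : (p - 1) * u ≤ m := by omega
  rw [fallingCoeff_eq_sum hle]
  refine padicNorm_sum_eq (a := Pi.single (p - 1) u) ?_ (by positivity) ?_ fun a ha hne => ?_
  · rw [Finset.mem_filter]
    exact ⟨single_mem_exponentVectors hle, sum_single_sub_one hle (fun i x => i * x) fun _ => rfl⟩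
  · refine h.padicNorm_logMonomial_single hm hn hm.symm ?_
    rw [hn, h.digitSum_n_add_u, digitSum_pow_mul]
  · rw [Finset.mem_filter] at ha
    refine h.padicNorm_logMonomial_lt hm hn (Z := p ^ b * q) (by rw [ha.2]; omega) ?_
    have h1 := h.digitSum_add_sum_le_of_weight_le hn (s := Finset.Icc 1 m) (a := a)
      (x := 0) (Nat.zero_le _)
    rw [digitSum_zero, zero_add] at h1
    -- Among positive indices only `p - 1` has no slack.
    have h2 : 0 < ∑ i ∈ Finset.Icc 1 m, logSlack p i * a i := by
      rw [Nat.pos_iff_ne_zero, Ne, Finset.sum_eq_zero_iff]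
      intro hzero
      refine hne (eq_single_of_pure ha.1 (fun i hi hip => ?_) ha.2)
      exact (Nat.mul_eq_zero.1 (hzero i hi)).resolve_left
        (logSlack_pos (Finset.mem_Icc.1 hi).1 hip).ne'
    omega

theorem coeff_higherBernoulli (hk : 0 < k) (m i : ℕ) :
    (higherBernoulli (-(k : ℤ)) m).coeff i = ∑ w ∈ Finset.range (m + 1),
      fallingCoeff m (m + k) w *
        ((((descPochhammer ℤ (m - w)).comp (Polynomial.X - 1)).coeff i : ℤ) : ℚ) := by
  rw [higherBernoulli_eq hk, Polynomial.finsetSum_coeff]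
  simp only [Polynomial.coeff_C_mul, Polynomial.coeff_map, eq_intCast]

theorem natDegree_descPochhammer_comp (j : ℕ) :
    ((descPochhammer ℤ j).comp (Polynomial.X - 1)).natDegree = j := by
  rw [Polynomial.natDegree_comp, descPochhammer_natDegree, ← Polynomial.C_1,
    Polynomial.natDegree_X_sub_C, mul_one]

theorem coeff_descPochhammer_comp_self (j : ℕ) :
    ((descPochhammer ℤ j).comp (Polynomial.X - 1)).coeff j = 1 := by
  have h : ((descPochhammer ℤ j).comp (Polynomial.X - Polynomial.C 1)).Monic :=
    (monic_descPochhammer ℤ j).comp_X_sub_C 1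
  rw [Polynomial.C_1] at h
  have h1 := h.coeff_natDegree
  rwa [natDegree_descPochhammer_comp] at h1

theorem padicNorm_mul_int_le (x : ℚ) (z : ℤ) : padicNorm p (x * z) ≤ padicNorm p x := by
  rw [padicNorm.mul]
  exact mul_le_of_le_one_right (padicNorm.nonneg _) (padicNorm.of_int z)

theorem padicNorm_coeff_le (h : IsSplitting p b c r q u k)
    (hm : m = (p - 1) * u + p ^ b * q) (hn : m + k = r + p ^ b * (c + q)) (i : ℕ) :
    padicNorm p ((higherBernoulli (-(k : ℤ)) m).coeff i) ≤ (p : ℚ) ^ poleOrder p u := by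
  rw [coeff_higherBernoulli h.k_pos]
  refine padicNorm.sum_le' (fun w hw => (padicNorm_mul_int_le _ _).trans ?_) (by positivity)
  exact h.padicNorm_fallingCoeff_le hm hn (by rw [Finset.mem_range] at hw; omega)

theorem padicNorm_coeff_lt (h : IsSplitting p b c r q u k)
    (hm : m = (p - 1) * u + p ^ b * q) (hn : m + k = r + p ^ b * (c + q)) {i : ℕ}
    (hi : p ^ b * q < i) :
    padicNorm p ((higherBernoulli (-(k : ℤ)) m).coeff i) < (p : ℚ) ^ poleOrder p u := by
  have hp0 : (0 : ℚ) < p := by exact_mod_cast hp.out.pos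
  rw [coeff_higherBernoulli h.k_pos]
  refine padicNorm.sum_lt' (fun w hw => ?_) (by positivity)
  rcases lt_or_ge w ((p - 1) * u) with hlt | hge
  · exact (padicNorm_mul_int_le _ _).trans_lt (h.padicNorm_fallingCoeff_lt hm hn hlt)
  · rw [Polynomial.coeff_eq_zero_of_natDegree_lt
      (by rw [natDegree_descPochhammer_comp]; omega)]
    simp [hp.out.pos]

theorem padicNorm_coeff_eq (h : IsSplitting p b c r q u k)
    (hm : m = (p - 1) * u + p ^ b * q) (hn : m + k = r + p ^ b * (c + q)) :
    padicNorm p ((higherBernoulli (-(k : ℤ)) m).coeff (p ^ b * q)) =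
      (p : ℚ) ^ poleOrder p u := by
  have hp0 : (0 : ℚ) < p := by exact_mod_cast hp.out.pos
  rw [coeff_higherBernoulli h.k_pos]
  refine padicNorm_sum_eq (a := (p - 1) * u) (Finset.mem_range.2 (by omega)) (by positivity)
    ?_ fun w hw hne => ?_
  · have h1 : m - (p - 1) * u = p ^ b * q := by omega
    rw [h1, coeff_descPochhammer_comp_self, Int.cast_one, mul_one,
      h.padicNorm_fallingCoeff_eq hm hn]
  · rcases lt_or_gt_of_ne hne with hlt | hgt
    · exact (padicNorm_mul_int_le _ _).trans_lt (h.padicNorm_fallingCoeff_lt hm hn hlt)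
    · rw [Finset.mem_range] at hw
      rw [Polynomial.coeff_eq_zero_of_natDegree_lt
        (by rw [natDegree_descPochhammer_comp]; omega)]
      simp [hp.out.pos]

theorem maxPole_higherBernoulli (h : IsSplitting p b c r q u k)
    (hm : m = (p - 1) * u + p ^ b * q) (hn : m + k = r + p ^ b * (c + q)) :
    maxPole p (higherBernoulli (-(k : ℤ)) m) = poleOrder p u :=
  maxPole_eq (h.padicNorm_coeff_le hm hn) (hasPoleOfOrder_iff.2 (h.padicNorm_coeff_eq hm hn))

theorem firstPoleInDegree_higherBernoulli (h : IsSplitting p b c r q u k)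
    (hm : m = (p - 1) * u + p ^ b * q) (hn : m + k = r + p ^ b * (c + q)) :
    FirstPoleInDegree p (higherBernoulli (-(k : ℤ)) m) (poleOrder p u) (p ^ b * q) := by
  refine ⟨hasPoleOfOrder_iff.2 (h.padicNorm_coeff_eq hm hn), fun i hi => ?_⟩
  by_contra! hlt
  exact (h.padicNorm_coeff_lt hm hn hlt).ne (hasPoleOfOrder_iff.1 hi)

/-- Since `(p-1) f + f = p f`, the digit `c` stays intact below the digits of `f`. -/
theorem digitSum_n_add_top {f : ℕ} (h : IsSplitting p b c r ((p - 1) * f) u k) :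
    digitSum p (r + p ^ b * (c + (p - 1) * f) + (u + p ^ b * f)) =
      digitSum p r + c + digitSum p (u + p ^ b * f) := by
  have h1 := add_lt_of_digitSum_add_eq h.r_lt h.u_lt h.digitSum_low
  have h2 : r + p ^ b * (c + (p - 1) * f) + (u + p ^ b * f) = (r + u) + p ^ b * (c + p * f) := by
    obtain ⟨a, ha⟩ : ∃ a, p = a + 1 := ⟨p - 1, by have := hp.out.one_lt; omega⟩
    have h3 : p * f = (p - 1) * f + f := by
      conv_lhs => rw [ha]
      rw [ha, Nat.add_sub_cancel]
      ring
    rw [h3]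
    ring
  have h4 := h.c_le
  rw [h2, digitSum_add_pow_mul h1, h.digitSum_low, digitSum_add_mul (by omega),
    digitSum_add_pow_mul h.u_lt]
  ring

theorem hasPoleOfOrder_coeff_zero {f : ℕ} (h : IsSplitting p b c r ((p - 1) * f) u k)
    (hm : m = (p - 1) * u + p ^ b * ((p - 1) * f))
    (hn : m + k = r + p ^ b * (c + (p - 1) * f)) :
    HasPoleOfOrder p ((higherBernoulli (-(k : ℤ)) m).coeff 0) (poleOrder p u) := by
  have hp0 : (0 : ℚ) < p := by exact_mod_cast hp.out.pos
  have hM : (0 : ℚ) < (p : ℚ) ^ poleOrder p u := by positivity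
  have hp1 := hp.out.one_lt
  have hD : m = (p - 1) * (u + p ^ b * f) := by rw [hm]; ring
  have hpos : 0 < r + c := by
    have h1 := h.k_pos
    have h2 := h.k_add
    by_contra! hle
    obtain ⟨rfl, rfl⟩ : r = 0 ∧ c = 0 := by omega
    simp at h2
    omega
  have hsmall : ∀ a : ℕ → ℕ, ∀ Z, ∑ i ∈ Finset.Icc 1 m, i * a i + Z = m → Z < p →
      (Z = 0 → ∃ i ∈ Finset.Icc 1 m, i ≠ 0 ∧ i ≠ p - 1 ∧ a i ≠ 0) →
      padicNorm p (logMonomial m (m + k) a) < (p : ℚ) ^ poleOrder p u := by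
    intro a Z hZ hZp hne
    refine h.padicNorm_logMonomial_lt hm hn hZ ?_
    rw [hn]
    exact digitSum_add_sum_lt h.c_le h.r_lt h.u_lt h.mul_lt h.digitSum_low hpos (hZ.trans hm)
      hZp hne
  rw [hasPoleOfOrder_iff, coeff_zero_higherBernoulli h.k_pos]
  refine padicNorm_sum_eq (a := m) (Finset.mem_range.2 (by omega)) hM ?_ fun w hw hne => ?_
  · rw [Nat.sub_self, pow_zero, Nat.factorial_zero, Nat.cast_one, mul_one, mul_one,
      fallingCoeff_eq_sum le_rfl]
    refine padicNorm_sum_eq (a := Pi.single (p - 1) (u + p ^ b * f)) ?_ hM ?_ fun a ha hne => ?_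
    · rw [Finset.mem_filter]
      exact ⟨single_mem_exponentVectors hD.ge,
        (sum_single_sub_one hD.ge (fun i x => i * x) fun _ => rfl).trans hD.symm⟩
    · refine h.padicNorm_logMonomial_single hm hn (Z := 0) hD.symm ?_
      rw [hn, h.digitSum_n_add_top, digitSum_zero, add_zero]
    · rw [Finset.mem_filter] at ha
      refine hsmall a 0 ha.2 hp.out.pos fun _ => ?_
      by_contra! hcon
      exact hne (eq_single_of_pure ha.1
        (fun i hi hip => hcon i hi (Nat.one_le_iff_ne_zero.1 (Finset.mem_Icc.1 hi).1) hip)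
        (ha.2.trans hD))
  · rw [Finset.mem_range] at hw
    have hint : ((-1) ^ (m - w) * (m - w)! : ℚ) = (((-1) ^ (m - w) * (m - w)! : ℤ) : ℚ) := by
      push_cast; rfl
    rw [hint]
    -- A remainder below `p` makes every monomial strictly smaller; otherwise `p` divides `(m -
    -- w)!`.
    rcases lt_or_ge (m - w) p with hlt | hge
    · refine (padicNorm_mul_int_le _ _).trans_lt ?_
      rw [fallingCoeff_eq_sum (by omega)]
      refine padicNorm.sum_lt' (fun a ha => ?_) hM
      rw [Finset.mem_filter] at ha
      exact hsmall a (m - w) (by rw [ha.2]; omega) hlt fun h0 => by omega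
    · rw [padicNorm.mul]
      have h1 := h.padicNorm_fallingCoeff_le hm hn (w := w) (by omega)
      have h2 : padicNorm p (((-1) ^ (m - w) * (m - w)! : ℤ) : ℚ) < 1 := by
        rw [padicNorm.int_lt_one_iff]
        refine Dvd.dvd.mul_left ?_ _
        exact_mod_cast (hp.out.dvd_factorial).2 hge
      calc _ ≤ (p : ℚ) ^ poleOrder p u * padicNorm p (((-1) ^ (m - w) * (m - w)! : ℤ) : ℚ) :=
            mul_le_mul_of_nonneg_right h1 (padicNorm.nonneg _)
        _ < (p : ℚ) ^ poleOrder p u * 1 := mul_lt_mul_of_pos_left h2 hM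
        _ = _ := mul_one _

theorem padicValNat_stirlingSecond {f : ℕ} (h : IsSplitting p b c r ((p - 1) * f) u k)
    (hm : m = (p - 1) * u + p ^ b * ((p - 1) * f))
    (hn : m + k = r + p ^ b * (c + (p - 1) * f)) :
    (padicValNat p (Nat.stirlingSecond (m + k) k) : ℤ) =
      padicValNat p ((m + k).choose k) - poleOrder p u := by
  have h1 := h.hasPoleOfOrder_coeff_zero hm hn
  have h2 := choose_mul_coeff_zero_higherBernoulli h.k_pos m
  have h3 : ((m + k).choose k : ℚ) ≠ 0 := by
    exact_mod_cast (Nat.choose_pos (Nat.le_add_left k m)).ne'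
  have h4 := congrArg (padicValRat p) h2
  rw [padicValRat.mul h3 h1.1, h1.2, padicValRat.of_nat, padicValRat.of_nat] at h4
  rw [← h4]
  ring

end IsSplitting

end PoleOrder

/-! ### The theorem. -/

theorem mainTheorem7 (p n k B : ℕ) (hp : p.Prime) (hB : IsBottomSegment p n B)
    (hk : 0 < k) (hkB : k ≤ B) (hdvd : p - 1 ∣ B - k)
    (hchoose : ¬ p ∣ (n + (B - k) / (p - 1)).choose n) :
    ((maxPole p (higherBernoulli (-(k : ℤ)) (n - k)) : ℚ) =
        (digitSum p (B - k) : ℚ) / ((p : ℚ) - 1) ∧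
      FirstPoleInDegree p (higherBernoulli (-(k : ℤ)) (n - k))
        (maxPole p (higherBernoulli (-(k : ℤ)) (n - k))) (n - B)) ∧
    (p - 1 ∣ n - k →
      IsAMZC p n k ∧
      (padicValNat p (Nat.stirlingSecond n k) : ℚ) =
        ((digitSum p k : ℚ) - (digitSum p B : ℚ)) / ((p : ℚ) - 1)) := by
  have : Fact p.Prime := ⟨hp⟩
  have hp1 := hp.one_lt
  obtain ⟨b, c, r, q, hc, hr, hBeq, hneq, hhigh⟩ := hB.exists_split
  obtain ⟨u, hu⟩ := hdvd
  rw [hu, Nat.mul_div_cancel_left _ (by omega)] at hchoose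
  have hnu := digitSum_add_of_not_dvd_choose hchoose
  -- A carry within `r + u` would already lower the digit sum of `n + u`.
  have hlow : digitSum p (r + u) = digitSum p r + digitSum p u := by
    have h1 : digitSum p n = digitSum p r + digitSum p (c + q) := by
      rw [hneq, digitSum_add_pow_mul hr]
    have h2 : digitSum p (n + u) ≤ digitSum p (r + u) + digitSum p (c + q) := by
      rw [hneq, add_right_comm]
      refine (digitSum_add_le _ _).trans ?_
      rw [digitSum_pow_mul]
    have h3 := digitSum_add_le (p := p) r u
    omega
  have h : IsSplitting p b c r q u k := ⟨hc, hr, hk, by omega, hlow, hhigh⟩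
  have hmul : p ^ b * (c + q) = p ^ b * c + p ^ b * q := mul_add _ _ _
  obtain ⟨m, rfl⟩ : ∃ m, n = m + k := ⟨n - k, by omega⟩
  have hm : m = (p - 1) * u + p ^ b * q := by omega
  have hM := h.maxPole_higherBernoulli hm hneq
  have hpq : (p : ℚ) - 1 ≠ 0 := by
    rw [sub_ne_zero]
    exact_mod_cast hp1.ne'
  have hMq : ((p : ℚ) - 1) * poleOrder p u = digitSum p ((p - 1) * u) := by
    rw [← sub_one_mul_poleOrder u]
    push_cast [hp1.le]
    ring
  rw [Nat.add_sub_cancel, hM, hu, show m + k - B = p ^ b * q by omega]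
  refine ⟨⟨?_, h.firstPoleInDegree_higherBernoulli hm hneq⟩, fun hdvd' => ?_⟩
  · rw [eq_div_iff hpq, mul_comm, hMq]
  · have hcop : Nat.Coprime (p - 1) (p ^ b) := by
      refine Nat.Coprime.pow_right b ?_
      rw [Nat.coprime_comm, Nat.coprime_self_sub_right hp1.le]
      exact Nat.coprime_one_right p
    have hq : p - 1 ∣ q := by
      refine hcop.dvd_of_dvd_mul_left ?_
      rw [hm] at hdvd'
      exact (Nat.dvd_add_right (Dvd.intro _ rfl)).1 hdvd'
    obtain ⟨f, rfl⟩ := hq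
    have hS := h.padicValNat_stirlingSecond hm hneq
    refine ⟨?_, ?_⟩
    · rw [IsAMZC, Nat.add_sub_cancel, hM, hS]
    -- In Kummer's formula the digit sum of `q` cancels between `m` and `n`, and that of `(p-1) u`
    -- cancels against the pole order.
    · have h1 := sub_one_mul_padicValRat_choose (p := p) k m
      rw [add_comm k m, padicValRat.of_nat] at h1
      have h2 : digitSum p (m + k) = digitSum p B + digitSum p ((p - 1) * f) := by
        rw [hneq, hBeq, h.digitSum_n, h.digitSum_B]
      have h3 : digitSum p m = digitSum p ((p - 1) * u) + digitSum p ((p - 1) * f) := by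
        rw [hm]; exact h.digitSum_m
      rw [h2, h3] at h1
      generalize padicValNat p ((m + k).choose k) = v at h1 hS
      generalize padicValNat p (Nat.stirlingSecond (m + k) k) = w at hS ⊢
      have hS' := congrArg (Int.cast (R := ℚ)) hS
      have h1' := congrArg (Int.cast (R := ℚ)) h1
      push_cast at hS' h1'
      rw [eq_div_iff hpq, hS']
      linear_combination h1' - hMq
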